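/- Let $V$ be a unitary space of dimension $n\ge 3$ over the finite field $\mathbb K=\mathrm{GF}(q^2)$, i.e. an $n$-dimensional $\mathbb K$-vector space with a non-degenerate Hermitian form $\Psi$ with respect to the field automorphism $\tau$ of order $2$ of $\mathbb K$ (so $\tau(x)=x^q$). Let $\mathcal G(V)$ be the graph whose vertices are the $1$-dimensional subspaces of $V$ on which $\Psi$ is non-degenerate, two distinct vertices being adjacent if and only if they are orthogonal. Put $$d_m=\frac{q^{m-2}\bigl(q^{m-1}-(-1)^{m-1}\bigr)}{q+1},\qquad \mu_1=d_n,\quad \mu_2=q^{n-2},\quad \mu_3=(-1)^n q^{n-3},\quad \mu_4=-q^{n-2},$$ $$\alpha_2=\frac{d_nd_{n+1}}{2q^{2n-3}}\cdot\frac{q^2-q-1-(-1)^n}{q-1},\qquad \alpha_3=\frac{d_nd_{n-1}}{q^{2n-8}(q-1)},\qquad \alpha_4=\frac{d_nd_{n+1}}{2q^{2n-3}}\cdot\frac{q^2-q-1+(-1)^n}{q-1}.$$ Then $\mathcal G(V)$ is $d_n$-regular, every eigenvalue of its adjacency matrix is one of $\mu_1,\mu_2,\mu_3,\mu_4$, and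 the multiplicities (algebraic and, equally, geometric; multiplicity $0$ meaning that the number is not an eigenvalue) are as follows. - If $q\ne 2$: $\mu_1,\mu_2,\mu_3,\mu_4$ have multiplicities $1,\alpha_2,\alpha_3,\alpha_4$ respectively. - If $q=2$ and $n$ is even: $\mu_1,\mu_2,\mu_3,\mu_4$ have multiplicities $1,0,\alpha_3,\alpha_2+\alpha_4$ respectively. - If $q=2$ and $n>3$ is odd: $\mu_1,\mu_2,\mu_3,\mu_4$ have multiplicities $1,\alpha_2+\alpha_4,\alpha_3,0$ respectively. - If $q=2$ and $n=3$: $\mu_1=\mu_2=2$ has multiplicity $4=1+\alpha_2+\alpha_4$, $\mu_3=-1$ has multiplicity $8=\alpha_3$, and $\mu_4=-2$ has multiplicity $0$. -/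

import Mathlib

/-- `Ψ` is a non-degenerate Hermitian form with respect to `τ`: it is linear in the first argument,
`τ`-semilinear in the second one, satisfies `Ψ v w = τ (Ψ w v)`, and has trivial radical. Here `τ`
is required to be a field automorphism of order two, so that `(V, Ψ)` is a unitary space. -/
structure IsUnitary {K V : Type*} [Field K] [AddCommGroup V] [Module K V] (τ : K ≃+* K)
    (Ψ : V →ₗ[K] V →ₛₗ[(τ : K →+* K)] K) : Prop where
  orderOf_eq_two : orderOf τ = 2
  hermitian : ∀ v w : V, Ψ v w = τ (Ψ w v)
  nondegenerate : ∀ v : V, (∀ w : V, Ψ v w = 0) → v = 0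

/-- The vertices of `𝒢(V)`: the `1`-dimensional subspaces on which the restriction of `Ψ` is
non-degenerate. -/
def NondegLine {K V : Type*} [Field K] [AddCommGroup V] [Module K V] {τ : K ≃+* K}
    (Ψ : V →ₗ[K] V →ₛₗ[(τ : K →+* K)] K) : Type _ :=
  {S : Submodule K V // Module.finrank K S = 1 ∧ ∀ v ∈ S, (∀ w ∈ S, Ψ v w = 0) → v = 0}

/-- The graph `𝒢(V)` on the non-degenerate `1`-dimensional subspaces. Adjacency is orthogonality
(imposed in both orders; for a Hermitian form either order implies the other one). -/
def orthoGraph {K V : Type*} [Field K] [AddCommGroup V] [Module K V] {τ : K ≃+* K}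
    (Ψ : V →ₗ[K] V →ₛₗ[(τ : K →+* K)] K) : SimpleGraph (NondegLine Ψ) where
  Adj S T := S ≠ T ∧ ∀ v ∈ S.1, ∀ w ∈ T.1, Ψ v w = 0 ∧ Ψ w v = 0
  symm := ⟨fun _ _ h => ⟨h.1.symm, fun v hv w hw => (h.2 w hw v hv).symm⟩⟩
  loopless := ⟨fun _ h => h.1 rfl⟩

noncomputable instance NondegLine.instFintype {K V : Type*} [Field K] [Finite K] [AddCommGroup V]
    [Module K V] [FiniteDimensional K V] {τ : K ≃+* K}
    (Ψ : V →ₗ[K] V →ₛₗ[(τ : K →+* K)] K) : Fintype (NondegLine Ψ) :=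
  have : Finite V := Module.finite_of_finite K
  have : Finite (NondegLine Ψ) :=
    Finite.of_injective (fun S : NondegLine Ψ => (S.1 : Set V))
      (fun _ _ h => Subtype.ext (SetLike.coe_injective h))
  Fintype.ofFinite _

open Classical in
/-- The real adjacency matrix of `𝒢(V)`. -/
noncomputable def orthoAdjMatrix {K V : Type*} [Field K] [AddCommGroup V]
    [Module K V] {τ : K ≃+* K}
    (Ψ : V →ₗ[K] V →ₛₗ[(τ : K →+* K)] K) : Matrix (NondegLine Ψ) (NondegLine Ψ) ℝ :=
  (orthoGraph Ψ).adjMatrix ℝ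

open Classical in
/-- `m` is the multiplicity of `μ` as an eigenvalue of the matrix `A`, both as a root of the
characteristic polynomial and as the dimension of the eigenspace (the two agree for symmetric real
matrices); multiplicity `0` means that `μ` is not an eigenvalue. -/
def HasMultiplicity {ι : Type*} [Fintype ι] (A : Matrix ι ι ℝ) (μ m : ℝ) : Prop :=
  (A.charpoly.rootMultiplicity μ : ℝ) = m ∧
    (Module.finrank ℝ (Module.End.eigenspace A.mulVecLin μ) : ℝ) = m

/-- `d_m = q^(m-2) (q^(m-1) - (-1)^(m-1)) / (q+1)`. -/
noncomputable def dNum (q : ℕ) (m : ℤ) : ℝ :=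
  (q : ℝ) ^ (m - 2) * ((q : ℝ) ^ (m - 1) - (-1) ^ (m - 1)) / ((q : ℝ) + 1)

noncomputable def alphaTwo (q : ℕ) (n : ℤ) : ℝ :=
  dNum q n * dNum q (n + 1) / (2 * (q : ℝ) ^ (2 * n - 3)) *
    (((q : ℝ) ^ 2 - q - 1 - (-1) ^ n) / ((q : ℝ) - 1))

noncomputable def alphaThree (q : ℕ) (n : ℤ) : ℝ :=
  dNum q n * dNum q (n - 1) / ((q : ℝ) ^ (2 * n - 8) * ((q : ℝ) - 1))

noncomputable def alphaFour (q : ℕ) (n : ℤ) : ℝ :=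
  dNum q n * dNum q (n + 1) / (2 * (q : ℝ) ^ (2 * n - 3)) *
    (((q : ℝ) ^ 2 - q - 1 + (-1) ^ n) / ((q : ℝ) - 1))

/-! Write n = k + 3, Q = q^k, ε = (-1)^k. Let A be the adjacency matrix, N the number of vertices, d
the degree, J the all-ones matrix, and B the indicator of the pairs of lines that coincide or span a
degenerate plane.

The entries of A² and AB reduce to counting vectors of given norm in t^⊥ or {s, t}^⊥. Such a count
depends only on the dimension of the subspace, that of its radical, and whether the norm is zero
(`formCount_eq`). Hence A² is a combination of J, I, B (`orthoAdjMatrix_sq`), and AB one of J, I, B,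
A (`orthoAdjMatrix_mul_tangentMatrix`). Eliminating B gives (A - qQ)(A + εQ)(A + qQ) = κJ
(`isThreeRegular_orthoAdjMatrix`).

An eigenvector whose eigenvalue differs from d is killed by J, so its eigenvalue is a root of the
cubic. A quadratic polynomial in A, corrected by a multiple of J, projects onto the eigenspace of a
simple root other than d; its trace, known from tr A = 0 and tr A² = Nd, is the multiplicity
(`finrank_eigenspace_of_ne`). The degree is itself a root only for q = 2, n = 3; then κ = 0 and no
correction is needed (`finrank_eigenspace_of_eq`). The other exceptions at q = 2 only express that
α₂ or α₄ vanishes. -/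

/-! ### Norms and fixed points of an involution of a finite field. -/

section HermitianField

variable {K : Type*} [Field K] [Finite K] {q : ℕ} {τ : K ≃+* K}

theorem involutive_of_orderOf_eq_two {K : Type*} [Field K] {τ : K ≃+* K} (hτ : orderOf τ = 2)
    (x : K) : τ (τ x) = x := by
  have h : τ ^ 2 = 1 := hτ ▸ pow_orderOf_eq_one τ
  rw [pow_two] at h
  exact RingEquiv.congr_fun h x

theorem exists_apply_ne_of_orderOf_eq_two {K : Type*} [Field K] {τ : K ≃+* K}
    (hτ : orderOf τ = 2) : ∃ x, τ x ≠ x := by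
  by_contra! h
  have h1 : τ = 1 := RingEquiv.ext h
  rw [h1, orderOf_one] at hτ
  omega

/-- The trace is nonzero in every characteristic: if it vanished, its value at 1 would give 1 + 1 =
0, and then x + τ x = 0 would read τ x = x for all x. -/
theorem exists_add_apply_ne_zero {K : Type*} [Field K] {τ : K ≃+* K} (hτ : orderOf τ = 2) :
    ∃ x, x + τ x ≠ 0 := by
  by_contra! h
  obtain ⟨x, hx⟩ := exists_apply_ne_of_orderOf_eq_two hτ
  have h1 := h 1
  have h2 := h x
  rw [map_one] at h1
  apply hx
  linear_combination h2 - x * h1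

/-- By Artin's theorem K has degree 2 over the fixed field, so q² is the square of the order of that
field. -/
theorem card_fixed_of_orderOf_eq_two {K : Type*} [Field K] {q : ℕ} {τ : K ≃+* K}
    (hq : Nat.card K = q ^ 2) (hτ : orderOf τ = 2) :
    Nat.card {x : K // τ x = x} = q := by
  have hfin : Finite (Subgroup.zpowers τ) := by
    apply Nat.finite_of_card_ne_zero
    rw [Nat.card_zpowers, hτ]; norm_num
  have := Fintype.ofFinite (Subgroup.zpowers τ)
  have h1 := FixedPoints.finrank_eq_card (Subgroup.zpowers τ) K
  rw [← Nat.card_eq_fintype_card, Nat.card_zpowers, hτ] at h1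
  have h2 := Module.natCard_eq_pow_finrank (K := FixedPoints.subfield (Subgroup.zpowers τ) K)
    (V := K)
  rw [h1, hq] at h2
  have h3 : Nat.card (FixedPoints.subfield (Subgroup.zpowers τ) K) = q :=
    (Nat.pow_left_injective (n := 2) two_ne_zero h2).symm
  rw [← h3]
  refine Nat.card_congr (Equiv.subtypeEquivRight fun x => ⟨fun h => ?_, fun h => ?_⟩)
  · rintro ⟨g, hg⟩
    obtain ⟨k, rfl⟩ := Subgroup.mem_zpowers_iff.1 hg
    change (τ ^ k) x = x
    have : τ ∈ MulAction.stabilizer (K ≃+* K) x := h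
    exact zpow_mem this k
  · exact h ⟨τ, Subgroup.mem_zpowers τ⟩

/-- The norm homomorphism `x ↦ x * τ x` on units. -/
noncomputable def unitsNorm {K : Type*} [Field K] (τ : K ≃+* K) : Kˣ →* Kˣ where
  toFun x := x * Units.map (τ : K →* K) x
  map_one' := by simp
  map_mul' x y := by rw [map_mul, mul_mul_mul_comm]

/-- The homomorphism `x ↦ x / τ x` on units. -/
noncomputable def unitsQuot {K : Type*} [Field K] (τ : K ≃+* K) : Kˣ →* Kˣ where
  toFun x := x / Units.map (τ : K →* K) x
  map_one' := by simp
  map_mul' x y := by rw [map_mul, mul_div_mul_comm]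

theorem mem_ker_unitsNorm {K : Type*} [Field K] {τ : K ≃+* K} {x : Kˣ} :
    x ∈ (unitsNorm τ).ker ↔ (x : K) * τ x = 1 := by
  rw [MonoidHom.mem_ker, Units.ext_iff]; rfl

theorem mem_ker_unitsQuot {K : Type*} [Field K] {τ : K ≃+* K} {x : Kˣ} :
    x ∈ (unitsQuot τ).ker ↔ τ x = x := by
  rw [MonoidHom.mem_ker]
  change x / Units.map (τ : K →* K) x = 1 ↔ _
  rw [div_eq_one, Units.ext_iff, eq_comm]; rfl

theorem card_ker_unitsQuot (hq : Nat.card K = q ^ 2) (hτ : orderOf τ = 2) :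
    Nat.card (unitsQuot τ).ker + 1 = q := by
  rw [← card_fixed_of_orderOf_eq_two hq hτ, ← Finite.card_option]
  have e : {x : K // τ x = x} ≃ Option (unitsQuot τ).ker := by
    refine Equiv.symm (Equiv.ofBijective
      (fun o => o.elim ⟨0, map_zero τ⟩ fun x => ⟨x.1, mem_ker_unitsQuot.1 x.2⟩) ⟨?_, ?_⟩)
    · rintro (_ | ⟨x, hx⟩) (_ | ⟨y, hy⟩) h
      · rfl
      · exact absurd (congrArg Subtype.val h).symm y.ne_zero
      · exact absurd (congrArg Subtype.val h) x.ne_zero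
      · exact congrArg some (Subtype.ext (Units.ext (congrArg Subtype.val h)))
    · rintro ⟨x, hx⟩
      by_cases h : x = 0
      · exact ⟨none, Subtype.ext h.symm⟩
      · exact ⟨some ⟨Units.mk0 x h, mem_ker_unitsQuot.2 hx⟩, rfl⟩
  exact (Nat.card_congr e).symm

/-- Hilbert 90 for an involution. -/
theorem range_unitsQuot {K : Type*} [Field K] {τ : K ≃+* K} (hτ : orderOf τ = 2) :
    (unitsQuot τ).range = (unitsNorm τ).ker := by
  have hinv := involutive_of_orderOf_eq_two hτ
  ext x
  rw [mem_ker_unitsNorm]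
  constructor
  · rintro ⟨y, rfl⟩
    have h1 : ((unitsQuot τ y : Kˣ) : K) = y / τ y := by
      change ((y / Units.map (τ : K →* K) y : Kˣ) : K) = _
      rw [Units.val_div_eq_div_val]; rfl
    have h2 : τ y ≠ 0 := by simp
    rw [h1, map_div₀, hinv]
    field_simp
  · intro h
    -- For y = z + x τ z, the relation x τ x = 1 gives x τ y = y. If no z made y nonzero, z = 1
    -- would force x = -1 and then τ would be trivial.
    obtain ⟨z, hz⟩ : ∃ z : K, z + x * τ z ≠ 0 := by
      by_contra! hz
      obtain ⟨w, hw⟩ := exists_apply_ne_of_orderOf_eq_two hτ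
      have h1 := hz 1
      have h2 := hz w
      rw [map_one] at h1
      apply hw
      linear_combination -h2 + τ w * h1
    refine ⟨Units.mk0 _ hz, Units.ext ?_⟩
    change ((Units.mk0 _ hz / Units.map (τ : K →* K) (Units.mk0 _ hz) : Kˣ) : K) = _
    rw [Units.val_div_eq_div_val]
    change (z + x * τ z) / τ (z + x * τ z) = x
    have h3 : τ (z + x * τ z) ≠ 0 := (map_ne_zero τ).2 hz
    rw [div_eq_iff h3, map_add, map_mul, hinv]
    linear_combination (-z) * h

theorem one_lt_of_card_eq_sq (hq : Nat.card K = q ^ 2) : 1 < q := by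
  have := Finite.one_lt_card (α := K)
  rw [hq] at this
  by_contra! h
  interval_cases q <;> simp at this

theorem card_units_eq (hq : Nat.card K = q ^ 2) : Nat.card Kˣ + 1 = q ^ 2 := by
  classical
  have := Fintype.ofFinite K
  rw [← hq, Nat.card_eq_fintype_card, Nat.card_eq_fintype_card, Fintype.card_units]
  have := Fintype.card_pos (α := K)
  omega

/-- By Hilbert 90 this kernel is the image of x ↦ x / τ x, of order (q² - 1) / (q - 1). -/
theorem card_ker_unitsNorm (hq : Nat.card K = q ^ 2) (hτ : orderOf τ = 2) :
    Nat.card (unitsNorm τ).ker = q + 1 := by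
  have h1 := (unitsQuot τ).ker.card_mul_index
  rw [Subgroup.index_ker, mul_comm] at h1
  rw [range_unitsQuot hτ] at h1
  have h2 := card_ker_unitsQuot hq hτ
  have h3 := card_units_eq hq
  have h4 := one_lt_of_card_eq_sq hq
  rw [← h1] at h3
  generalize Nat.card (unitsQuot τ).ker = k at *
  generalize Nat.card (unitsNorm τ).ker = m at *
  subst h2
  have hk : 0 < k := by omega
  have : k * m = k * (k + 1 + 1) := by linarith [h3, sq (k + 1), mul_comm k m, mul_add k k 1]
  exact Nat.eq_of_mul_eq_mul_left hk this

/-- Norms are fixed by τ, and the image of the norm has order (q² - 1) / (q + 1) = q - 1, the number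
of all nonzero fixed elements. -/
theorem range_unitsNorm (hq : Nat.card K = q ^ 2) (hτ : orderOf τ = 2) :
    (unitsNorm τ).range = (unitsQuot τ).ker := by
  have hinv := involutive_of_orderOf_eq_two hτ
  apply Subgroup.eq_of_le_of_card_ge
  · rintro _ ⟨y, rfl⟩
    rw [mem_ker_unitsQuot]
    change τ (y * τ y) = y * τ y
    rw [map_mul, hinv, mul_comm]
  · have h1 := (unitsNorm τ).ker.card_mul_index
    rw [Subgroup.index_ker, mul_comm] at h1
    have h2 := card_ker_unitsQuot hq hτ
    have h3 := card_units_eq hq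
    rw [← h1, card_ker_unitsNorm hq hτ] at h3
    subst h2
    nlinarith

/-- By surjectivity of the norm onto fixed units, the fibre is a coset of the norm kernel. -/
theorem card_norm_eq (hq : Nat.card K = q ^ 2) (hτ : orderOf τ = 2) {b : K} (hb : τ b = b)
    (hb0 : b ≠ 0) : Nat.card {x : K // x * τ x = b} = q + 1 := by
  have hmem : Units.mk0 b hb0 ∈ (unitsNorm τ).range := by
    rw [range_unitsNorm hq hτ, mem_ker_unitsQuot]; exact hb
  obtain ⟨y, hy⟩ := hmem
  have hy' : (y : K) * τ y = b := congrArg Units.val hy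
  rw [← card_ker_unitsNorm hq hτ]
  symm
  refine Nat.card_congr (Equiv.ofBijective
    (fun z => ⟨z.1 * y, ?_⟩) ⟨?_, ?_⟩)
  · have := mem_ker_unitsNorm.1 z.2
    rw [map_mul]
    linear_combination b * this + (z.1 * τ z.1 : K) * hy'
  · intro z w h
    have h' : (z.1 : K) * y = w.1 * y := congrArg Subtype.val h
    exact Subtype.ext (Units.ext (mul_right_cancel₀ y.ne_zero h'))
  · rintro ⟨x, hx⟩
    have hx0 : x ≠ 0 := by rintro rfl; simp at hx; exact hb0 hx.symm
    have hy1 : τ y ≠ 0 := by simp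
    refine ⟨⟨Units.mk0 x hx0 / y, ?_⟩, ?_⟩
    · rw [mem_ker_unitsNorm, Units.val_div_eq_div_val, map_div₀, Units.val_mk0, div_mul_div_comm,
        hx, hy', div_self hb0]
    · apply Subtype.ext
      simp [Units.val_div_eq_div_val]

theorem exists_mul_apply_eq (hq : Nat.card K = q ^ 2) (hτ : orderOf τ = 2) {b : K} (hb : τ b = b)
    (hb0 : b ≠ 0) : ∃ x : K, x * τ x = b := by
  have h := card_norm_eq hq hτ hb hb0
  have : Nonempty {x : K // x * τ x = b} := (Nat.card_pos_iff.1 (by omega)).1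
  exact ⟨this.some.1, this.some.2⟩

end HermitianField

/-! ### Sesquilinearity and symmetry of orthogonality. -/

namespace IsUnitary

variable {K V : Type*} [Field K] [AddCommGroup V] [Module K V] {τ : K ≃+* K}
  {Ψ : V →ₗ[K] V →ₛₗ[(τ : K →+* K)] K}

theorem smul_right (Ψ : V →ₗ[K] V →ₛₗ[(τ : K →+* K)] K) (v w : V) (c : K) :
    Ψ v (c • w) = τ c * Ψ v w := by
  rw [LinearMap.map_smulₛₗ]; rfl

theorem smul_left (Ψ : V →ₗ[K] V →ₛₗ[(τ : K →+* K)] K) (v w : V) (c : K) :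
    Ψ (c • v) w = c * Ψ v w := by
  rw [map_smul]; rfl

theorem add_left (Ψ : V →ₗ[K] V →ₛₗ[(τ : K →+* K)] K) (v v' w : V) :
    Ψ (v + v') w = Ψ v w + Ψ v' w := by
  rw [map_add]; rfl

theorem sub_left (Ψ : V →ₗ[K] V →ₛₗ[(τ : K →+* K)] K) (v v' w : V) :
    Ψ (v - v') w = Ψ v w - Ψ v' w := by
  rw [map_sub]; rfl

theorem eq_zero_comm (hΨ : IsUnitary τ Ψ) {v w : V} : Ψ v w = 0 ↔ Ψ w v = 0 := by
  rw [hΨ.hermitian v w, map_eq_zero]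

theorem eq_zero_of_forall_left (hΨ : IsUnitary τ Ψ) {v : V} (h : ∀ w, Ψ w v = 0) : v = 0 :=
  hΨ.nondegenerate v fun w => hΨ.eq_zero_comm.1 (h w)

end IsUnitary

/-! ### Counting vectors of given norm in a possibly degenerate subspace. -/

section Counting

open IsUnitary

variable {K V : Type*} [Field K] [AddCommGroup V] [Module K V] {τ : K ≃+* K}
  {Ψ : V →ₗ[K] V →ₛₗ[(τ : K →+* K)] K}

/-- The vectors orthogonal to `s`. -/
def perpTo (Ψ : V →ₗ[K] V →ₛₗ[(τ : K →+* K)] K) (s : V) : Submodule K V where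
  carrier := {v | Ψ v s = 0}
  zero_mem' := by simp
  add_mem' {a b} ha hb := by
    change Ψ (a + b) s = 0
    rw [add_left, show Ψ a s = 0 from ha, show Ψ b s = 0 from hb, add_zero]
  smul_mem' c a ha := by
    change Ψ (c • a) s = 0
    rw [smul_left, show Ψ a s = 0 from ha, mul_zero]

theorem mem_perpTo {s v : V} : v ∈ perpTo Ψ s ↔ Ψ v s = 0 := Iff.rfl

/-- The radical of the restriction of the form to `W`. -/
def radicalOn (Ψ : V →ₗ[K] V →ₛₗ[(τ : K →+* K)] K) (W : Submodule K V) : Submodule K V where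
  carrier := {v | v ∈ W ∧ ∀ w ∈ W, Ψ v w = 0}
  zero_mem' := by simp
  add_mem' {a b} ha hb :=
    ⟨W.add_mem ha.1 hb.1, fun w hw => by rw [add_left, ha.2 w hw, hb.2 w hw, add_zero]⟩
  smul_mem' c a ha :=
    ⟨W.smul_mem c ha.1, fun w hw => by rw [smul_left, ha.2 w hw, mul_zero]⟩

theorem finrank_inf_perpTo [FiniteDimensional K V] {W : Submodule K V} {s w : V} (hw : w ∈ W)
    (h : Ψ w s ≠ 0) :
    Module.finrank K (W ⊓ perpTo Ψ s : Submodule K V) + 1 = Module.finrank K W := by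
  let φ : Module.Dual K W :=
    { toFun := fun v => Ψ v s
      map_add' := fun a b => add_left Ψ _ _ _
      map_smul' := fun c a => smul_left Ψ _ _ _ }
  have hφ : φ ≠ 0 := fun h0 => h (LinearMap.congr_fun h0 ⟨w, hw⟩)
  have h1 : LinearMap.ker φ = (perpTo Ψ s).comap W.subtype := by
    ext v; rfl
  rw [← Module.Dual.finrank_ker_add_one_of_ne_zero hφ, h1,
    ← Submodule.finrank_map_subtype_eq W ((perpTo Ψ s).comap W.subtype),
    Submodule.map_comap_subtype]

/-- Polarization: if all norms on W vanish but Ψ v w ≠ 0, scale v so that Ψ (c • v) w = x has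
nonzero trace; the norm of c • v + w is then x + τ x ≠ 0. -/
theorem exists_anisotropic (hΨ : IsUnitary τ Ψ) {W : Submodule K V} (hW : radicalOn Ψ W ≠ W) :
    ∃ s ∈ W, Ψ s s ≠ 0 := by
  by_contra! h
  apply hW
  refine le_antisymm (fun v hv => hv.1) fun v hv => ⟨hv, fun w hw => ?_⟩
  by_contra hvw
  obtain ⟨x, hx⟩ := exists_add_apply_ne_zero hΨ.orderOf_eq_two
  apply hx
  set c := x / Ψ v w with hc
  have h1 : c * Ψ v w = x := div_mul_cancel₀ _ hvw
  have h2 : Ψ w (c • v) = τ x := by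
    rw [hΨ.hermitian, smul_left, h1]
  have h3 := h (c • v + w) (W.add_mem (W.smul_mem c hv) hw)
  rw [map_add, add_left, add_left, h2, h w hw, h _ (W.smul_mem c hv), smul_left, h1] at h3
  linear_combination h3

/-- W is the orthogonal sum of the anisotropic line of s and W ∩ s^⊥, so splitting off s leaves the
radical unchanged. -/
theorem radicalOn_inf_perpTo {W : Submodule K V} {s : V} (hs : s ∈ W)
    (h : Ψ s s ≠ 0) : radicalOn Ψ (W ⊓ perpTo Ψ s) = radicalOn Ψ W := by
  ext v
  constructor
  · rintro ⟨⟨hv, hvs⟩, hv2⟩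
    refine ⟨hv, fun w hw => ?_⟩
    have h1 : w - (Ψ w s / Ψ s s) • s ∈ W ⊓ perpTo Ψ s := by
      refine ⟨W.sub_mem hw (W.smul_mem _ hs), ?_⟩
      rw [SetLike.mem_coe, mem_perpTo, sub_left, smul_left, div_mul_cancel₀ _ h, sub_self]
    have h2 := hv2 _ h1
    rwa [map_sub, smul_right, mem_perpTo.1 hvs, mul_zero, sub_zero] at h2
  · rintro ⟨hv, hv2⟩
    exact ⟨⟨hv, hv2 s hs⟩, fun w hw => hv2 w hw.1⟩

/-- The number of vectors of `W` at which the Hermitian form takes the value `a`. -/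
noncomputable def formCount (Ψ : V →ₗ[K] V →ₛₗ[(τ : K →+* K)] K) (W : Submodule K V) (a : K) :
    ℕ := Nat.card {v : V // v ∈ W ∧ Ψ v v = a}

/-- A nonzero fixed value has q + 1 preimages under the norm and zero has one; a single formula
covers both so that it can be summed. -/
theorem card_norm_mul_eq [Finite K] {q : ℕ} (hq : Nat.card K = q ^ 2) (hτ : orderOf τ = 2)
    {b c : K} (hb : τ b = b) (hc : τ c = c) (hc0 : c ≠ 0) [Decidable (b = 0)] :
    (Nat.card {x : K // x * τ x * c = b} : ℝ) = q + 1 - q * (if b = 0 then 1 else 0) := by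
  have e : ∀ x, x * τ x * c = b ↔ x * τ x = b / c := fun x => (eq_div_iff hc0).symm
  rw [Nat.card_congr (Equiv.subtypeEquivRight e)]
  split_ifs with h
  · subst h
    have : Unique {x : K // x * τ x = 0 / c} :=
      ⟨⟨0, by simp⟩, fun x => Subtype.ext (by simpa using x.2)⟩
    rw [Nat.card_unique]; push_cast; ring
  · rw [card_norm_eq hq hτ (by rw [map_div₀, hb, hc]) (div_ne_zero h hc0)]
    push_cast; ring

/-- Write v = x • s + w with w ⟂ s. For each w, the coefficient x must satisfy a norm equation with
q + 1 solutions, or one when Ψ w w = a; summing over w gives the recursion. -/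
theorem formCount_inf_perpTo [Finite K] [Finite V] {q : ℕ} (hq : Nat.card K = q ^ 2)
    (hΨ : IsUnitary τ Ψ) {W : Submodule K V} {s : V} (hs : s ∈ W) (h : Ψ s s ≠ 0) {a : K}
    (ha : τ a = a) :
    (formCount Ψ W a : ℝ) = (q + 1) * Nat.card (W ⊓ perpTo Ψ s : Submodule K V) -
      q * formCount Ψ (W ⊓ perpTo Ψ s) a := by
  classical
  set W' := W ⊓ perpTo Ψ s with hW'
  have hQ : ∀ (x : K) (w : V), w ∈ W' → Ψ (x • s + w) (x • s + w) = x * τ x * Ψ s s + Ψ w w := by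
    intro x w hw
    have h1 : Ψ w s = 0 := hw.2
    have h2 : Ψ s w = 0 := hΨ.eq_zero_comm.1 h1
    rw [map_add, add_left, add_left, smul_left, smul_left, smul_right, smul_right, h1, h2]
    ring
  have e : (Σ w : W', {x : K // x * τ x * Ψ s s = a - Ψ w.1 w.1}) ≃
      {v : V // v ∈ W ∧ Ψ v v = a} := by
    refine Equiv.ofBijective (fun p => ⟨p.2.1 • s + p.1.1,
      W.add_mem (W.smul_mem _ hs) p.1.2.1, ?_⟩) ⟨?_, ?_⟩
    · rw [hQ _ _ p.1.2, p.2.2]; ring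
    · rintro ⟨⟨w, hw⟩, ⟨x, hx⟩⟩ ⟨⟨w', hw'⟩, ⟨x', hx'⟩⟩ heq
      have h1 : x • s + w = x' • s + w' := congrArg Subtype.val heq
      have h2 := congrArg (fun v => Ψ v s) h1
      simp only [add_left, smul_left, mem_perpTo.1 hw.2, mem_perpTo.1 hw'.2, add_zero] at h2
      have h3 := mul_right_cancel₀ h h2
      subst h3
      have h4 := add_left_cancel h1
      subst h4
      rfl
    · rintro ⟨v, hv, hva⟩
      have h1 : v - (Ψ v s / Ψ s s) • s ∈ W' := by
        refine ⟨W.sub_mem hv (W.smul_mem _ hs), ?_⟩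
        rw [SetLike.mem_coe, mem_perpTo, sub_left, smul_left, div_mul_cancel₀ _ h, sub_self]
      refine ⟨⟨⟨_, h1⟩, ⟨Ψ v s / Ψ s s, ?_⟩⟩, Subtype.ext (by simp)⟩
      rw [← hva, eq_sub_iff_add_eq, ← hQ _ _ h1]
      simp
  have := Fintype.ofFinite W'
  have hfix : ∀ v, τ (Ψ v v) = Ψ v v := fun v => (hΨ.hermitian v v).symm
  have hcount : formCount Ψ W' a = Nat.card {w : W' // a - Ψ w.1 w.1 = 0} := by
    refine Nat.card_congr ((Equiv.subtypeSubtypeEquivSubtypeInter (· ∈ W')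
      (fun v => Ψ v v = a)).symm.trans (Equiv.subtypeEquivRight fun w => ?_))
    rw [sub_eq_zero, eq_comm]
  rw [formCount, ← Nat.card_congr e, Nat.card_sigma, hcount]
  push_cast
  rw [Finset.sum_congr rfl fun w _ => card_norm_mul_eq hq hΨ.orderOf_eq_two
    (show τ (a - Ψ w.1 w.1) = a - Ψ w.1 w.1 by rw [map_sub, ha, hfix]) (hfix s) h]
  rw [Finset.sum_sub_distrib, ← Finset.mul_sum, Finset.sum_boole, Finset.sum_const,
    Nat.card_eq_fintype_card (α := W'),
    Nat.card_eq_fintype_card (α := {w : W' // a - Ψ w.1 w.1 = 0}),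
    Fintype.card_subtype fun w : W' => a - Ψ w.1 w.1 = 0, Finset.card_univ, nsmul_eq_mul]
  ring

theorem card_submodule_eq [Finite K] [FiniteDimensional K V] {q : ℕ} (hq : Nat.card K = q ^ 2)
    (W : Submodule K V) : Nat.card W = q ^ (2 * Module.finrank K W) := by
  rw [Module.natCard_eq_pow_finrank (K := K), hq, pow_mul]

/-- Induction on the rank r of the form on W: split off anisotropic vectors until only the radical
remains, where all norms are zero. The factor q on the left avoids a negative exponent at r = 0. -/
theorem formCount_eq [Finite K] [FiniteDimensional K V] {q : ℕ} (hq : Nat.card K = q ^ 2)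
    (hΨ : IsUnitary τ Ψ) {a : K} (ha : τ a = a) [Decidable (a = 0)] {d r : ℕ}
    {W : Submodule K V} (hd : Module.finrank K (radicalOn Ψ W) = d)
    (hr : Module.finrank K W = d + r) :
    (q : ℝ) * formCount Ψ W a = (q : ℝ) ^ (2 * (d + r)) +
      (q : ℝ) ^ (2 * d) * (-q : ℝ) ^ r * (q * (if a = 0 then 1 else 0) - 1) := by
  have : Finite V := Module.finite_of_finite K
  induction r generalizing W with
  | zero =>
    have h1 : radicalOn Ψ W = W :=
      Submodule.eq_of_le_of_finrank_eq (fun v hv => hv.1) (by rw [hd, hr, add_zero])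
    have h2 : ∀ v ∈ W, Ψ v v = 0 := fun v hv => (h1.ge hv).2 v hv
    split_ifs with h
    · subst h
      have h3 : formCount Ψ W 0 = Nat.card W :=
        Nat.card_congr (Equiv.subtypeEquivRight fun v => ⟨fun h => h.1, fun h => ⟨h, h2 v h⟩⟩)
      rw [h3, card_submodule_eq hq, hr]
      push_cast; ring
    · have h3 : formCount Ψ W a = 0 := by
        have : IsEmpty {v : V // v ∈ W ∧ Ψ v v = a} :=
          ⟨fun v => h (by rw [← v.2.2, h2 _ v.2.1])⟩
        exact Nat.card_of_isEmpty
      rw [h3]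
      push_cast; ring
  | succ r ih =>
    have h1 : radicalOn Ψ W ≠ W := by
      intro h1
      rw [h1] at hd; omega
    obtain ⟨s, hs, hss⟩ := exists_anisotropic hΨ h1
    have h2 := finrank_inf_perpTo hs hss
    have h3 := ih (W := W ⊓ perpTo Ψ s) (by rw [radicalOn_inf_perpTo hs hss, hd]) (by omega)
    rw [formCount_inf_perpTo hq hΨ hs hss ha, card_submodule_eq hq,
      show Module.finrank K (W ⊓ perpTo Ψ s : Submodule K V) = d + r by omega]
    push_cast
    linear_combination (-q : ℝ) * h3

end Counting

/-! ### The subspace orthogonal to two unit vectors and its radical. -/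

section TwoVectors

open IsUnitary

variable {K V : Type*} [Field K] [AddCommGroup V] [Module K V] [FiniteDimensional K V]
  {τ : K ≃+* K} {Ψ : V →ₗ[K] V →ₛₗ[(τ : K →+* K)] K} {n : ℕ} {s t : V}

omit [FiniteDimensional K V] in
theorem radicalOn_top (hΨ : IsUnitary τ Ψ) : radicalOn Ψ ⊤ = ⊥ := by
  rw [eq_bot_iff]
  exact fun v hv => hΨ.nondegenerate v fun w => hv.2 w trivial

theorem finrank_perpTo (hn : Module.finrank K V = n + 1) (ht : Ψ t t = 1) :
    Module.finrank K (perpTo Ψ t) = n := by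
  have h := finrank_inf_perpTo (Ψ := Ψ) (W := ⊤) (s := t) (w := t) trivial (by rw [ht]; simp)
  rw [top_inf_eq, finrank_top, hn] at h
  omega

omit [FiniteDimensional K V] in
theorem radicalOn_perpTo (hΨ : IsUnitary τ Ψ) (ht : Ψ t t = 1) :
    radicalOn Ψ (perpTo Ψ t) = ⊥ := by
  have h := radicalOn_inf_perpTo (W := ⊤) (s := t) trivial (by rw [ht]; simp)
  rwa [top_inf_eq, radicalOn_top hΨ] at h

-- The hypothesis on s says that s is not on the line of t. If s were orthogonal to t^⊥, then s - Ψ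
-- s t • t would be orthogonal to everything.
omit [FiniteDimensional K V] in
theorem exists_mem_perpTo_ne_zero (hΨ : IsUnitary τ Ψ) (ht : Ψ t t = 1)
    (hst : s ≠ Ψ s t • t) : ∃ w ∈ perpTo Ψ t, Ψ w s ≠ 0 := by
  by_contra! h
  apply hst
  rw [← sub_eq_zero]
  apply hΨ.eq_zero_of_forall_left
  intro w
  have h1 : w - Ψ w t • t ∈ perpTo Ψ t := by
    rw [mem_perpTo, sub_left, smul_left, ht]; ring
  have h2 := h _ h1
  rw [sub_left, smul_left] at h2
  rw [map_sub, smul_right, ← hΨ.hermitian]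
  linear_combination h2

theorem finrank_perpTo_inf (hΨ : IsUnitary τ Ψ) (hn : Module.finrank K V = n + 2)
    (ht : Ψ t t = 1) (hst : s ≠ Ψ s t • t) :
    Module.finrank K (perpTo Ψ t ⊓ perpTo Ψ s : Submodule K V) = n := by
  obtain ⟨w, hw, hws⟩ := exists_mem_perpTo_ne_zero hΨ ht hst
  have h := finrank_inf_perpTo hw hws
  rw [finrank_perpTo hn ht] at h
  omega

-- Both v and s - Ψ s t • t are orthogonal to t and to t^⊥ ∩ s^⊥. These span a hyperplane, so the
-- functionals they define on V are proportional.
omit [FiniteDimensional K V] in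
theorem exists_smul_of_mem_radicalOn (hΨ : IsUnitary τ Ψ) (ht : Ψ t t = 1)
    (hst : s ≠ Ψ s t • t) {v : V} (hv : v ∈ radicalOn Ψ (perpTo Ψ t ⊓ perpTo Ψ s)) :
    ∃ c : K, v = c • (s - Ψ s t • t) := by
  obtain ⟨w₀, hw₀, hw₀s⟩ := exists_mem_perpTo_ne_zero hΨ ht hst
  -- The scalar is chosen so that both sides pair equally with w₀, which spans V modulo that
  -- hyperplane.
  obtain ⟨c, hc⟩ := τ.surjective (Ψ w₀ v / Ψ w₀ s)
  refine ⟨c, ?_⟩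
  rw [← sub_eq_zero]
  apply hΨ.eq_zero_of_forall_left
  intro w
  have hvt : Ψ t v = 0 := hΨ.eq_zero_comm.1 hv.1.1
  set b := Ψ (w - Ψ w t • t) s / Ψ w₀ s with hb
  have h1 : w - Ψ w t • t - b • w₀ ∈ perpTo Ψ t ⊓ perpTo Ψ s := by
    constructor
    · rw [SetLike.mem_coe, mem_perpTo, sub_left, sub_left, smul_left, smul_left, ht,
        mem_perpTo.1 hw₀]
      ring
    · rw [SetLike.mem_coe, mem_perpTo, sub_left, smul_left Ψ w₀, hb,
        div_mul_cancel₀ _ hw₀s, sub_self]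
  have h2 := hΨ.eq_zero_comm.1 (hv.2 _ h1)
  rw [sub_left, sub_left, smul_left, smul_left, hvt] at h2
  rw [map_sub, smul_right, map_sub, smul_right, ← hΨ.hermitian, hc]
  rw [hb, sub_left, smul_left] at h2
  field_simp at h2 ⊢
  linear_combination h2

-- The only candidate for the radical, s - Ψ s t • t, pairs with s to the Gram determinant 1 - Ψ s t
-- · τ (Ψ s t) of s and t; when this is nonzero, no nonzero multiple lies in s^⊥.
omit [FiniteDimensional K V] in
theorem radicalOn_perpTo_inf_of_ne (hΨ : IsUnitary τ Ψ) (ht : Ψ t t = 1) (hs : Ψ s s = 1)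
    (hst : s ≠ Ψ s t • t) (h : Ψ s t * τ (Ψ s t) ≠ 1) :
    radicalOn Ψ (perpTo Ψ t ⊓ perpTo Ψ s) = ⊥ := by
  rw [eq_bot_iff]
  intro v hv
  obtain ⟨c, rfl⟩ := exists_smul_of_mem_radicalOn hΨ ht hst hv
  have h1 := mem_perpTo.1 hv.1.2
  rw [smul_left, sub_left, smul_left, hs, hΨ.hermitian t s] at h1
  rcases mul_eq_zero.1 h1 with h2 | h2
  · rw [h2, zero_smul]; exact zero_mem _
  · exact absurd (sub_eq_zero.1 h2).symm h

omit [FiniteDimensional K V] in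
theorem finrank_radicalOn_perpTo_inf_of_eq (hΨ : IsUnitary τ Ψ) (ht : Ψ t t = 1)
    (hs : Ψ s s = 1) (hst : s ≠ Ψ s t • t) (h : Ψ s t * τ (Ψ s t) = 1) :
    Module.finrank K (radicalOn Ψ (perpTo Ψ t ⊓ perpTo Ψ s)) = 1 := by
  have h1 : radicalOn Ψ (perpTo Ψ t ⊓ perpTo Ψ s) = K ∙ (s - Ψ s t • t) := by
    apply le_antisymm
    · intro v hv
      obtain ⟨c, rfl⟩ := exists_smul_of_mem_radicalOn hΨ ht hst hv
      exact Submodule.smul_mem _ c (Submodule.mem_span_singleton_self _)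
    · rw [Submodule.span_singleton_le_iff_mem]
      refine ⟨⟨?_, ?_⟩, fun w hw => ?_⟩
      · rw [SetLike.mem_coe, mem_perpTo, sub_left, smul_left, ht]; ring
      · rw [SetLike.mem_coe, mem_perpTo, sub_left, smul_left, hs, hΨ.hermitian t s, h, sub_self]
      · rw [sub_left, smul_left, hΨ.eq_zero_comm.1 hw.1, hΨ.eq_zero_comm.1 hw.2]; ring
  rw [h1, finrank_span_singleton (sub_ne_zero.2 hst)]

end TwoVectors

/-! ### Spectrum of a symmetric matrix with a cubic relation modulo J. -/

section SymmetricMatrix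
open Matrix

variable {ι : Type*} [Fintype ι] [DecidableEq ι] {A : Matrix ι ι ℝ}

omit [DecidableEq ι] in
theorem mem_eigenspace_mulVecLin {μ : ℝ} {v : ι → ℝ} :
    v ∈ Module.End.eigenspace A.mulVecLin μ ↔ A *ᵥ v = μ • v := by
  rw [Module.End.mem_eigenspace_iff, mulVecLin_apply]

/-- The hypotheses make E a projection onto the eigenspace, and the trace of a projection is its
rank. -/
theorem finrank_eigenspace_eq_trace {μ : ℝ} {E : Matrix ι ι ℝ} (hE : A * E = μ • E)
    (hfix : ∀ v, A *ᵥ v = μ • v → E *ᵥ v = v) :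
    (Module.finrank ℝ (Module.End.eigenspace A.mulVecLin μ) : ℝ) = E.trace := by
  have h : LinearMap.IsProj (Module.End.eigenspace A.mulVecLin μ) (Matrix.toLin' E) := by
    refine ⟨fun v => ?_, fun v hv => ?_⟩
    · rw [mem_eigenspace_mulVecLin, toLin'_apply, mulVec_mulVec, hE, smul_mulVec]
    · rw [toLin'_apply]
      exact hfix v (mem_eigenspace_mulVecLin.1 hv)
  rw [← h.trace, trace_toLin'_eq]

-- For symmetric real B, the squared length of B v is the inner product of v with B (B v).
omit [DecidableEq ι] in
theorem mulVec_eq_zero_of_sq {B : Matrix ι ι ℝ} (hB : Bᵀ = B) {v : ι → ℝ}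
    (h : B *ᵥ (B *ᵥ v) = 0) : B *ᵥ v = 0 := by
  rw [← dotProduct_self_eq_zero]
  conv_lhs => rw [dotProduct_mulVec, ← mulVec_transpose, hB, h, zero_dotProduct]

omit [DecidableEq ι] in
theorem mulVec_eq_zero_of_pow {B : Matrix ι ι ℝ} (hB : Bᵀ = B) {v : ι → ℝ} (k : ℕ)
    (h : (B.mulVecLin ^ (k + 1)) v = 0) : B *ᵥ v = 0 := by
  induction k with
  | zero => simpa using h
  | succ k ih =>
    apply ih
    rw [pow_succ', pow_succ', Module.End.mul_apply, Module.End.mul_apply, mulVecLin_apply,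
      mulVecLin_apply] at h
    rw [pow_succ', Module.End.mul_apply, mulVecLin_apply]
    exact mulVec_eq_zero_of_sq hB h

/-- This makes algebraic and geometric multiplicities agree. -/
theorem maxGenEigenspace_mulVecLin (hA : Aᵀ = A) (μ : ℝ) :
    Module.End.maxGenEigenspace A.mulVecLin μ = Module.End.eigenspace A.mulVecLin μ := by
  have hB : (A - μ • 1)ᵀ = A - μ • 1 := by simp [hA]
  have hlin : A.mulVecLin - μ • (1 : Module.End ℝ (ι → ℝ)) = (A - μ • 1).mulVecLin := by
    refine LinearMap.ext fun v => ?_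
    rw [mulVecLin_apply, sub_mulVec, smul_mulVec, one_mulVec]
    rfl
  ext v
  constructor
  · intro hv
    rw [Module.End.mem_maxGenEigenspace, hlin] at hv
    obtain ⟨k, hk⟩ := hv
    have h0 : (A - μ • 1) *ᵥ v = 0 := by
      apply mulVec_eq_zero_of_pow hB k
      rw [pow_succ', Module.End.mul_apply, hk, map_zero]
    rw [mem_eigenspace_mulVecLin]
    rwa [sub_mulVec, smul_mulVec, one_mulVec, sub_eq_zero] at h0
  · intro hv
    rw [Module.End.mem_maxGenEigenspace, hlin]
    refine ⟨1, ?_⟩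
    rw [mem_eigenspace_mulVecLin] at hv
    rw [pow_one, mulVecLin_apply, sub_mulVec, smul_mulVec, one_mulVec, hv, sub_self]

theorem hasMultiplicity_of_finrank {A : Matrix ι ι ℝ} (hA : Aᵀ = A) {μ m : ℝ}
    (h : (Module.finrank ℝ (Module.End.eigenspace A.mulVecLin μ) : ℝ) = m) :
    HasMultiplicity A μ m := by
  classical
  refine ⟨?_, h⟩
  rw [← h]
  have h1 := LinearMap.finrank_maxGenEigenspace_eq A.mulVecLin μ
  rw [maxGenEigenspace_mulVecLin hA] at h1
  rw [h1, ← Matrix.toLin'_apply', Matrix.charpoly_toLin']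
  congr!

variable (A) in
/-- `A` is a symmetric matrix with zero diagonal and constant row sums `d`, for which
`(A - a) (A - b) (A - c)` is a multiple of the all-ones matrix. -/
structure IsThreeRegular (d a b c κ : ℝ) : Prop where
  symm : Aᵀ = A
  trace : A.trace = 0
  rowSum : A *ᵥ (fun _ => 1) = fun _ => d
  trace_sq : (A * A).trace = Fintype.card ι * d
  cubic : (A - a • 1) * ((A - b • 1) * (A - c • 1)) = κ • of fun _ _ => 1

namespace IsThreeRegular

variable {d a b c κ : ℝ}

/-- The three factors commute, so a formula for the first root serves all three. -/
theorem rotate (h : IsThreeRegular A d a b c κ) : IsThreeRegular A d b c a κ where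
  symm := h.symm
  trace := h.trace
  rowSum := h.rowSum
  trace_sq := h.trace_sq
  cubic := by
    rw [← h.cubic]
    simp only [mul_sub, sub_mul, mul_smul_comm, smul_mul_assoc, mul_one, one_mul, smul_sub,
      smul_smul, mul_assoc]
    module

theorem mul_ones (h : IsThreeRegular A d a b c κ) :
    A * (of fun _ _ => 1) = d • of fun _ _ => (1 : ℝ) := by
  ext i j
  have := congrFun h.rowSum i
  simpa [mul_apply, mulVec, dotProduct] using this

theorem ones_mul (h : IsThreeRegular A d a b c κ) :
    (of fun _ _ => 1) * A = d • of fun _ _ => (1 : ℝ) := by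
  have := congrArg transpose h.mul_ones
  rw [transpose_mul, h.symm] at this
  exact this

theorem ones_mulVec (h : IsThreeRegular A d a b c κ) {μ : ℝ} {v : ι → ℝ} (hv : A *ᵥ v = μ • v) :
    (d - μ) • ((of fun _ _ => (1 : ℝ)) *ᵥ v : ι → ℝ) = 0 := by
  have h1 := congrArg (fun M => M *ᵥ v) h.ones_mul
  simp only at h1
  rw [← mulVec_mulVec, hv, mulVec_smul, smul_mulVec] at h1
  rw [sub_smul, h1, sub_self]

theorem cubic_mulVec (h : IsThreeRegular A d a b c κ) {μ : ℝ} {v : ι → ℝ} (hv : A *ᵥ v = μ • v) :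
    ((μ - a) * ((μ - b) * (μ - c))) • v = κ • ((of fun _ _ => (1 : ℝ)) *ᵥ v : ι → ℝ) := by
  have h1 := congrArg (fun M => M *ᵥ v) h.cubic
  simp only [← mulVec_mulVec, sub_mulVec, smul_mulVec, one_mulVec, hv, mulVec_sub, mulVec_smul]
    at h1
  rw [← h1]
  module

/-- Applying the cubic to an eigenvector and multiplying by d - μ kills the J term. -/
theorem eigenvalue (h : IsThreeRegular A d a b c κ) {μ : ℝ}
    (hμ : Module.End.HasEigenvalue A.mulVecLin μ) : μ = d ∨ μ = a ∨ μ = b ∨ μ = c := by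
  obtain ⟨v, hv, hv0⟩ := hμ.exists_hasEigenvector
  rw [mem_eigenspace_mulVecLin] at hv
  have h1 := congrArg ((d - μ) • ·) (h.cubic_mulVec hv)
  rw [smul_comm (d - μ) κ, h.ones_mulVec hv, smul_zero, smul_smul,
    smul_eq_zero_iff_left hv0] at h1
  simp only [mul_eq_zero, sub_eq_zero] at h1
  tauto

theorem smul_card [Nonempty ι] (h : IsThreeRegular A d a b c κ) :
    (d - a) * ((d - b) * (d - c)) = κ * Fintype.card ι := by
  have h1 := h.cubic_mulVec (μ := d) (v := fun _ => 1) (by rw [h.rowSum]; ext; simp)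
  have h2 := congrFun h1 (Classical.arbitrary ι)
  simpa [mulVec, dotProduct] using h2

/-- On a d-eigenvector the cubic is a nonzero scalar, so v is a multiple of J v; the projection is J
/ N. -/
theorem finrank_eigenspace_rowSum [Nonempty ι] (h : IsThreeRegular A d a b c κ) (hda : d ≠ a)
    (hdb : d ≠ b) (hdc : d ≠ c) :
    (Module.finrank ℝ (Module.End.eigenspace A.mulVecLin d) : ℝ) = 1 := by
  have hN : (Fintype.card ι : ℝ) ≠ 0 := by exact_mod_cast Fintype.card_ne_zero
  rw [finrank_eigenspace_eq_trace (E := (Fintype.card ι : ℝ)⁻¹ • of fun _ _ => 1)]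
  · simp [Matrix.trace, hN]
  · rw [mul_smul_comm, h.mul_ones, smul_comm]
  · intro v hv
    have h1 := h.cubic_mulVec hv
    have h2 := h.smul_card
    have h3 : (d - a) * ((d - b) * (d - c)) ≠ 0 :=
      mul_ne_zero (sub_ne_zero.2 hda) (mul_ne_zero (sub_ne_zero.2 hdb) (sub_ne_zero.2 hdc))
    rw [h2, mul_smul] at h1
    rw [h2] at h3
    have h4 := smul_right_injective _ (left_ne_zero_of_mul h3) h1
    rw [smul_mulVec, ← h4, smul_smul, inv_mul_cancel₀ hN, one_smul]

theorem trace_quadratic (h : IsThreeRegular A d a b c κ) :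
    ((A - b • 1) * (A - c • 1)).trace = Fintype.card ι * (d + b * c) := by
  simp only [mul_sub, sub_mul, mul_smul_comm, smul_mul_assoc, mul_one, one_mul, smul_sub,
    smul_smul, trace_sub, trace_smul, h.trace_sq, h.trace, trace_one, smul_eq_mul]
  ring

/-- The projection is the Lagrange polynomial (A - b)(A - c) / ((a - b)(a - c)), minus the multiple
of J that makes it vanish on the all-ones vector. -/
theorem finrank_eigenspace_of_ne [Nonempty ι] (h : IsThreeRegular A d a b c κ) (hab : a ≠ b)
    (hac : a ≠ c) (hda : d ≠ a) :
    (Module.finrank ℝ (Module.End.eigenspace A.mulVecLin a) : ℝ) =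
      (Fintype.card ι * (d + b * c) - (d - b) * (d - c)) / ((a - b) * (a - c)) := by
  have hN : (Fintype.card ι : ℝ) ≠ 0 := by exact_mod_cast Fintype.card_ne_zero
  have hD : (a - b) * (a - c) ≠ 0 := mul_ne_zero (sub_ne_zero.2 hab) (sub_ne_zero.2 hac)
  rw [finrank_eigenspace_eq_trace (E := ((a - b) * (a - c))⁻¹ • ((A - b • 1) * (A - c • 1) -
    ((d - b) * (d - c) / Fintype.card ι) • of fun _ _ => 1))]
  · rw [trace_smul, trace_sub, h.trace_quadratic, trace_smul]
    simp only [Matrix.trace, diag, of_apply, Finset.sum_const, Finset.card_univ, smul_eq_mul,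
      nsmul_eq_mul, mul_one]
    field_simp
  · rw [mul_smul_comm, smul_comm]
    congr 1
    rw [mul_sub, mul_smul_comm, h.mul_ones, smul_sub]
    have h1 := h.cubic
    rw [sub_mul, smul_mul_assoc, one_mul, sub_eq_iff_eq_add] at h1
    have h2 := h.smul_card
    have h3 : κ = (d - a) * ((d - b) * (d - c)) / Fintype.card ι := by
      rw [h2, mul_div_cancel_right₀ _ hN]
    rw [h1, h3]
    module
  · intro v hv
    have h1 : (of fun _ _ => (1 : ℝ)) *ᵥ v = 0 :=
      (smul_eq_zero_iff_right (sub_ne_zero.2 hda)).1 (h.ones_mulVec hv)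
    rw [smul_mulVec, sub_mulVec, smul_mulVec _ (of _), h1, ← mulVec_mulVec]
    simp only [sub_mulVec, smul_mulVec, one_mulVec, hv, mulVec_sub, mulVec_smul]
    rw [inv_smul_eq_iff₀ hD]
    module

/-- When d is the root a, evaluation on the all-ones vector gives κ = 0, so the uncorrected Lagrange
polynomial is already the projection. -/
theorem finrank_eigenspace_of_eq [Nonempty ι] (h : IsThreeRegular A a a b c κ) (hab : a ≠ b)
    (hac : a ≠ c) :
    (Module.finrank ℝ (Module.End.eigenspace A.mulVecLin a) : ℝ) =
      Fintype.card ι * (a + b * c) / ((a - b) * (a - c)) := by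
  have hN : (Fintype.card ι : ℝ) ≠ 0 := by exact_mod_cast Fintype.card_ne_zero
  have hD : (a - b) * (a - c) ≠ 0 := mul_ne_zero (sub_ne_zero.2 hab) (sub_ne_zero.2 hac)
  rw [finrank_eigenspace_eq_trace (E := ((a - b) * (a - c))⁻¹ • ((A - b • 1) * (A - c • 1)))]
  · rw [trace_smul, h.trace_quadratic, smul_eq_mul]
    field_simp
  · rw [mul_smul_comm, smul_comm]
    congr 1
    have h1 := h.cubic
    have h2 := h.smul_card
    have h3 : κ = 0 := by
      rw [sub_self, zero_mul] at h2
      exact (mul_eq_zero.1 h2.symm).resolve_right hN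
    rwa [sub_mul, smul_mul_assoc, one_mul, h3, zero_smul, sub_eq_zero] at h1
  · intro v hv
    rw [smul_mulVec, ← mulVec_mulVec]
    simp only [sub_mulVec, smul_mulVec, one_mulVec, hv, mulVec_sub, mulVec_smul]
    rw [inv_smul_eq_iff₀ hD]
    module

end IsThreeRegular

end SymmetricMatrix

/-! ### Vertices as unit vectors up to scalars of norm one. -/

namespace NondegLine

open IsUnitary

variable {K V : Type*} [Field K] [AddCommGroup V] [Module K V] {τ : K ≃+* K}
  {Ψ : V →ₗ[K] V →ₛₗ[(τ : K →+* K)] K} {q : ℕ}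

/-- `u` spans the line `S` and has norm one. -/
structure IsUnitRep (S : NondegLine Ψ) (u : V) : Prop where
  self : Ψ u u = 1
  mem_iff : ∀ v, v ∈ S.1 ↔ ∃ c : K, v = c • u

/-- A generator has nonzero norm fixed by τ; surjectivity of the norm lets it be rescaled to norm
one. -/
theorem exists_isUnitRep [Finite K] (hq : Nat.card K = q ^ 2) (hΨ : IsUnitary τ Ψ)
    (S : NondegLine Ψ) : ∃ u, IsUnitRep S u := by
  obtain ⟨⟨v, hvS⟩, hv0, hv⟩ := finrank_eq_one_iff'.1 S.2.1
  have hspan : ∀ w ∈ S.1, ∃ c : K, c • v = w := fun w hw => by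
    obtain ⟨c, hc⟩ := hv ⟨w, hw⟩
    exact ⟨c, congrArg Subtype.val hc⟩
  have hvv : Ψ v v ≠ 0 := by
    intro h
    refine hv0 (Subtype.ext (S.2.2 v hvS fun w hw => ?_))
    obtain ⟨c, rfl⟩ := hspan w hw
    rw [smul_right, h, mul_zero]
  have hfix : τ (Ψ v v)⁻¹ = (Ψ v v)⁻¹ := by rw [map_inv₀, ← hΨ.hermitian]
  obtain ⟨x, hx⟩ := exists_mul_apply_eq hq hΨ.orderOf_eq_two hfix (inv_ne_zero hvv)
  have hx0 : x ≠ 0 := by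
    rintro rfl
    rw [zero_mul] at hx
    exact inv_ne_zero hvv hx.symm
  refine ⟨x • v, ?_, fun w => ⟨fun hw => ?_, ?_⟩⟩
  · rw [smul_left, smul_right, ← mul_assoc, hx, inv_mul_cancel₀ hvv]
  · obtain ⟨c, rfl⟩ := hspan w hw
    exact ⟨c / x, by rw [smul_smul, div_mul_cancel₀ _ hx0]⟩
  · rintro ⟨c, rfl⟩
    exact S.1.smul_mem _ (S.1.smul_mem _ hvS)

/-- The line spanned by a vector of norm one. -/
def ofUnit (Ψ : V →ₗ[K] V →ₛₗ[(τ : K →+* K)] K) (u : V) (hu : Ψ u u = 1) : NondegLine Ψ :=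
  ⟨K ∙ u, finrank_span_singleton (by rintro rfl; simp at hu), fun v hv h => by
    obtain ⟨c, rfl⟩ := Submodule.mem_span_singleton.1 hv
    have h1 := h u (Submodule.mem_span_singleton_self u)
    rw [smul_left, hu, mul_one] at h1
    rw [h1, zero_smul]⟩

namespace IsUnitRep

variable {S T : NondegLine Ψ} {u v : V}

theorem mem (h : IsUnitRep S u) : u ∈ S.1 := (h.mem_iff u).2 ⟨1, (one_smul _ _).symm⟩

theorem le_iff (h : IsUnitRep S u) {W : Submodule K V} : S.1 ≤ W ↔ u ∈ W := by
  refine ⟨fun hW => hW h.mem, fun hu v hv => ?_⟩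
  obtain ⟨c, rfl⟩ := (h.mem_iff v).1 hv
  exact W.smul_mem c hu

theorem eq_of_smul (hS : IsUnitRep S u) (hT : IsUnitRep T v) {c : K} (h : u = c • v) : S = T := by
  have hc : c ≠ 0 := by
    rintro rfl
    have := hS.self
    rw [h] at this
    simp at this
  refine Subtype.ext (le_antisymm (hS.le_iff.2 ((hT.mem_iff u).2 ⟨c, h⟩))
    (hT.le_iff.2 ((hS.mem_iff v).2 ⟨c⁻¹, ?_⟩)))
  rw [h, inv_smul_smul₀ hc]

theorem adj_iff (hΨ : IsUnitary τ Ψ) (hS : IsUnitRep S u) (hT : IsUnitRep T v) :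
    (orthoGraph Ψ).Adj S T ↔ Ψ u v = 0 := by
  refine ⟨fun h => (h.2 u hS.mem v hT.mem).1, fun h => ⟨?_, fun x hx y hy => ?_⟩⟩
  · rintro rfl
    obtain ⟨c, hc⟩ := (hS.mem_iff v).1 hT.mem
    have := hT.self
    rw [hc, smul_left, ← hc, h, mul_zero] at this
    exact zero_ne_one this
  · obtain ⟨a, rfl⟩ := (hS.mem_iff x).1 hx
    obtain ⟨b, rfl⟩ := (hT.mem_iff y).1 hy
    have h' := hΨ.eq_zero_comm.1 h
    constructor
    · rw [smul_left, smul_right, h]; ring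
    · rw [smul_left, smul_right, h']; ring

theorem exists_of_norm_eq {x : V} (hx : Ψ x x = 1)
    (h : IsUnitRep (ofUnit Ψ x hx) u) :
    ∃ c : K, c * τ c = 1 ∧ u = c • x := by
  obtain ⟨c, hc⟩ := Submodule.mem_span_singleton.1 h.mem
  refine ⟨c, ?_, hc.symm⟩
  have := h.self
  rwa [← hc, smul_left, smul_right, hx, mul_one] at this

end IsUnitRep

/-- A vector of norm one spanning the line `S`, if there is any. -/
noncomputable def rep (S : NondegLine Ψ) : V := Classical.epsilon fun u => IsUnitRep S u

theorem isUnitRep_rep [Finite K] (hq : Nat.card K = q ^ 2) (hΨ : IsUnitary τ Ψ)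
    (S : NondegLine Ψ) : IsUnitRep S S.rep :=
  Classical.epsilon_spec (exists_isUnitRep hq hΨ S)

/-- Each line contains exactly q + 1 unit vectors, the multiples of its representative by scalars of
norm one. -/
theorem card_le [Finite K] [FiniteDimensional K V] (hq : Nat.card K = q ^ 2)
    (hΨ : IsUnitary τ Ψ) (W : Submodule K V) :
    (q + 1) * Nat.card {S : NondegLine Ψ // S.1 ≤ W} = formCount Ψ W 1 := by
  have hrep := isUnitRep_rep hq hΨ
  rw [← card_norm_eq hq hΨ.orderOf_eq_two (map_one τ) one_ne_zero, ← Nat.card_prod, formCount]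
  refine Nat.card_congr (Equiv.ofBijective (fun p => ⟨p.1.1 • p.2.1.rep,
    W.smul_mem _ ((hrep p.2.1).le_iff.1 p.2.2), ?_⟩) ⟨?_, ?_⟩)
  · rw [smul_left, smul_right, (hrep _).self, mul_one, p.1.2]
  · rintro ⟨⟨c, hc⟩, ⟨S, hS⟩⟩ ⟨⟨c', hc'⟩, ⟨S', hS'⟩⟩ heq
    have h1 : c • S.rep = c' • S'.rep := congrArg Subtype.val heq
    have hc0 : c ≠ 0 := left_ne_zero_of_mul_eq_one hc
    have h2 : S = S' := (hrep S).eq_of_smul (hrep S') (c := c⁻¹ * c') (by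
      rw [mul_smul, ← h1, inv_smul_smul₀ hc0])
    subst h2
    have h3 := congrArg (fun v => Ψ v S.rep) h1
    simp only [smul_left, (hrep S).self, mul_one] at h3
    subst h3
    rfl
  · rintro ⟨v, hv, hvv⟩
    obtain ⟨c, hc, hcv⟩ := (hrep (ofUnit Ψ v hvv)).exists_of_norm_eq hvv
    have hc0 : c ≠ 0 := left_ne_zero_of_mul_eq_one hc
    refine ⟨⟨⟨c⁻¹, ?_⟩, ⟨ofUnit Ψ v hvv, ?_⟩⟩, Subtype.ext ?_⟩
    · rw [map_inv₀, ← mul_inv, hc, inv_one]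
    · rw [ofUnit, Submodule.span_singleton_le_iff_mem]; exact hv
    · change c⁻¹ • (ofUnit Ψ v hvv).rep = v
      rw [hcv, inv_smul_smul₀ hc0]

/-- The number of isotropic vectors `r` orthogonal to `t` for which `r + t` is orthogonal to `s`. -/
noncomputable def tangentCount (Ψ : V →ₗ[K] V →ₛₗ[(τ : K →+* K)] K) (s t : V) : ℕ :=
  Nat.card {r : V // r ∈ perpTo Ψ t ∧ Ψ r r = 0 ∧ Ψ r s = -Ψ t s}

/-- Rescale the representative of U to have product 1 with t. Its difference r from t is then
isotropic and orthogonal to t, and orthogonality to s becomes Ψ r s = -Ψ t s. -/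
theorem card_tangent [Finite K] (hq : Nat.card K = q ^ 2) (hΨ : IsUnitary τ Ψ) {s t : V}
    (ht : Ψ t t = 1) :
    Nat.card {U : NondegLine Ψ // Ψ U.rep s = 0 ∧ Ψ U.rep t * τ (Ψ U.rep t) = 1} =
      tangentCount Ψ s t := by
  have hrep := isUnitRep_rep hq hΨ
  refine Nat.card_congr (Equiv.ofBijective (fun U => ⟨(Ψ U.1.rep t)⁻¹ • U.1.rep - t, ?_⟩) ⟨?_, ?_⟩)
  · obtain ⟨U, hUs, hUt⟩ := U
    have hc0 : Ψ U.rep t ≠ 0 := left_ne_zero_of_mul_eq_one hUt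
    have htc : τ (Ψ U.rep t) ≠ 0 := right_ne_zero_of_mul_eq_one hUt
    refine ⟨?_, ?_, ?_⟩
    · rw [mem_perpTo, sub_left, smul_left, ht, inv_mul_cancel₀ hc0, sub_self]
    · rw [map_sub, sub_left, sub_left, smul_left, smul_left, smul_right, smul_right,
        (hrep U).self, ht, map_inv₀, hΨ.hermitian t U.rep, inv_mul_cancel₀ htc,
        inv_mul_cancel₀ hc0, mul_one, ← mul_inv, hUt, inv_one]
      ring
    · change Ψ ((Ψ U.rep t)⁻¹ • U.rep - t) s = -Ψ t s
      rw [sub_left, smul_left, hUs]; ring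
  · rintro ⟨U, hUs, hUt⟩ ⟨U', hUs', hUt'⟩ heq
    have hc0 : Ψ U.rep t ≠ 0 := left_ne_zero_of_mul_eq_one hUt
    have h1 : (Ψ U.rep t)⁻¹ • U.rep - t = (Ψ U'.rep t)⁻¹ • U'.rep - t :=
      congrArg Subtype.val heq
    have h2 := sub_left_injective h1
    rw [inv_smul_eq_iff₀ hc0, smul_smul] at h2
    exact Subtype.ext ((hrep U).eq_of_smul (hrep U') h2)
  · rintro ⟨r, hrt, hrr, hrs⟩
    rw [mem_perpTo] at hrt
    have htr := hΨ.eq_zero_comm.1 hrt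
    have hx : Ψ (r + t) (r + t) = 1 := by
      rw [map_add, add_left, add_left, hrr, hrt, htr, ht]; ring
    obtain ⟨c, hc, hcu⟩ := (hrep (ofUnit Ψ _ hx)).exists_of_norm_eq hx
    have hc0 : c ≠ 0 := left_ne_zero_of_mul_eq_one hc
    have hut : Ψ (ofUnit Ψ _ hx).rep t = c := by
      rw [hcu, smul_left, add_left, hrt, ht]; ring
    refine ⟨⟨ofUnit Ψ _ hx, ?_, ?_⟩, Subtype.ext ?_⟩
    · rw [hcu, smul_left, add_left, hrs]; ring
    · rw [hut, hc]
    · change (Ψ (ofUnit Ψ _ hx).rep t)⁻¹ • (ofUnit Ψ _ hx).rep - t = r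
      rw [hut, hcu, inv_smul_smul₀ hc0, add_sub_cancel_right]

theorem tangentCount_self {t : V} (ht : Ψ t t = 1) : tangentCount Ψ t t = 0 := by
  have : IsEmpty {r : V // r ∈ perpTo Ψ t ∧ Ψ r r = 0 ∧ Ψ r t = -Ψ t t} :=
    ⟨fun r => by
      have h := r.2.2.2
      rw [r.2.1, ht] at h
      simp at h⟩
  exact Nat.card_of_isEmpty

theorem tangentCount_of_orthogonal {s t : V} (hst : Ψ t s = 0) :
    tangentCount Ψ s t = formCount Ψ (perpTo Ψ t ⊓ perpTo Ψ s) 0 := by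
  refine Nat.card_congr (Equiv.subtypeEquivRight fun r => ?_)
  rw [hst, neg_zero, Submodule.mem_inf, mem_perpTo (s := s)]
  tauto

/-- Every isotropic vector of t^⊥ not orthogonal to s is a unique unit multiple of one with Ψ r s =
-Ψ t s; there are q² - 1 units. -/
theorem tangentCount_of_not_orthogonal [Finite K] [FiniteDimensional K V]
    (hq : Nat.card K = q ^ 2) {s t : V} (hst : Ψ t s ≠ 0) :
    ((q : ℝ) ^ 2 - 1) * tangentCount Ψ s t =
      formCount Ψ (perpTo Ψ t) 0 - formCount Ψ (perpTo Ψ t ⊓ perpTo Ψ s) 0 := by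
  classical
  have : Finite V := Module.finite_of_finite K
  have hne : -Ψ t s ≠ 0 := neg_ne_zero.2 hst
  have e : {v : V // v ∈ perpTo Ψ t ⊓ perpTo Ψ s ∧ Ψ v v = 0} ⊕
      Kˣ × {r : V // r ∈ perpTo Ψ t ∧ Ψ r r = 0 ∧ Ψ r s = -Ψ t s} ≃
      {v : V // v ∈ perpTo Ψ t ∧ Ψ v v = 0} := by
    refine Equiv.ofBijective (Sum.elim (fun v => ⟨v.1, v.2.1.1, v.2.2⟩)
      (fun p => ⟨(p.1 : K) • p.2.1, Submodule.smul_mem _ _ p.2.2.1, ?_⟩)) ⟨?_, ?_⟩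
    · rw [smul_left, smul_right, p.2.2.2.1]; ring
    · refine Function.Injective.sumElim
        (fun v w h => Subtype.ext (Subtype.mk.inj h)) ?_ ?_
      · rintro ⟨x, ⟨r, hr⟩⟩ ⟨x', ⟨r', hr'⟩⟩ h
        have h1 : (x : K) • r = (x' : K) • r' := congrArg Subtype.val h
        have h2 := congrArg (fun v => Ψ v s) h1
        simp only [smul_left, hr.2.2, hr'.2.2] at h2
        have h3 := Units.ext (mul_right_cancel₀ hne h2)
        subst h3
        have h4 := smul_right_injective V x.ne_zero h1
        subst h4
        rfl
      · rintro ⟨v, hv⟩ ⟨x, ⟨r, hr⟩⟩ h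
        have h1 : v = (x : K) • r := congrArg Subtype.val h
        have h2 := mem_perpTo.1 hv.1.2
        rw [h1, smul_left, hr.2.2] at h2
        exact mul_ne_zero x.ne_zero hne h2
    · rintro ⟨v, hvt, hvv⟩
      by_cases h : Ψ v s = 0
      · exact ⟨Sum.inl ⟨v, ⟨hvt, h⟩, hvv⟩, rfl⟩
      · have hx : Ψ v s / (-Ψ t s) ≠ 0 := div_ne_zero h hne
        refine ⟨Sum.inr ⟨Units.mk0 _ hx, ⟨(Ψ v s / (-Ψ t s))⁻¹ • v, ?_, ?_, ?_⟩⟩,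
          Subtype.ext (smul_inv_smul₀ hx v)⟩
        · exact Submodule.smul_mem _ _ hvt
        · rw [smul_left, smul_right, hvv]; ring
        · rw [smul_left, inv_div, div_mul_cancel₀ _ h]
  have h1 := Nat.card_congr e
  rw [Nat.card_sum, Nat.card_prod] at h1
  have h2 : (Nat.card Kˣ : ℝ) + 1 = (q : ℝ) ^ 2 := by exact_mod_cast card_units_eq hq
  have h3 : (formCount Ψ (perpTo Ψ t ⊓ perpTo Ψ s) 0 : ℝ) + Nat.card Kˣ * tangentCount Ψ s t =
      formCount Ψ (perpTo Ψ t) 0 := by exact_mod_cast h1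
  rw [← h3, ← h2]; ring

end NondegLine

/-! ### Entries of A² and AB, and the cubic relation. -/

namespace NondegLine

open IsUnitary Matrix

variable {K V : Type*} [Field K] [Finite K] [AddCommGroup V] [Module K V]
  [FiniteDimensional K V] {τ : K ≃+* K}
  {Ψ : V →ₗ[K] V →ₛₗ[(τ : K →+* K)] K} {q k : ℕ}

open Classical in
omit [FiniteDimensional K V] in
theorem orthoAdjMatrix_apply (hq : Nat.card K = q ^ 2) (hΨ : IsUnitary τ Ψ) (S T : NondegLine Ψ) :
    orthoAdjMatrix Ψ S T = if Ψ S.rep T.rep = 0 then 1 else 0 := by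
  have hrep := isUnitRep_rep hq hΨ
  rw [orthoAdjMatrix, SimpleGraph.adjMatrix_apply]
  simp only [(hrep S).adj_iff hΨ (hrep T)]

open Classical in
/-- The indicator matrix of the pairs of lines that coincide or span a degenerate plane. -/
noncomputable def tangentMatrix (Ψ : V →ₗ[K] V →ₛₗ[(τ : K →+* K)] K) :
    Matrix (NondegLine Ψ) (NondegLine Ψ) ℝ :=
  of fun S T => if Ψ S.rep T.rep * τ (Ψ S.rep T.rep) = 1 then 1 else 0

open Classical in
omit [Finite K] [FiniteDimensional K V] in
theorem tangentMatrix_apply (S T : NondegLine Ψ) : tangentMatrix Ψ S T =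
    if Ψ S.rep T.rep * τ (Ψ S.rep T.rep) = 1 then 1 else 0 := rfl

theorem sum_boole_mul_boole {ι : Type*} [Fintype ι] (p r : ι → Prop) [DecidablePred p]
    [DecidablePred r] :
    ∑ i, (if p i then (1 : ℝ) else 0) * (if r i then 1 else 0) =
      Nat.card {i // p i ∧ r i} := by
  rw [Nat.card_eq_fintype_card, Fintype.card_subtype, ← Finset.sum_boole]
  refine Finset.sum_congr rfl fun i _ => ?_
  by_cases hp : p i <;> simp [hp]

theorem sq_apply (hq : Nat.card K = q ^ 2) (hΨ : IsUnitary τ Ψ) (S T : NondegLine Ψ) :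
    ((q : ℝ) + 1) * (orthoAdjMatrix Ψ * orthoAdjMatrix Ψ) S T =
      formCount Ψ (perpTo Ψ T.rep ⊓ perpTo Ψ S.rep) 1 := by
  classical
  have hrep := isUnitRep_rep hq hΨ
  rw [← card_le hq hΨ, mul_apply]
  simp only [orthoAdjMatrix_apply hq hΨ]
  rw [sum_boole_mul_boole]
  push_cast
  congr 2
  refine Nat.card_congr (Equiv.subtypeEquivRight fun U => ?_)
  rw [(hrep U).le_iff, Submodule.mem_inf, mem_perpTo, mem_perpTo, hΨ.eq_zero_comm, and_comm]

theorem mul_tangentMatrix_apply (hq : Nat.card K = q ^ 2) (hΨ : IsUnitary τ Ψ)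
    (S T : NondegLine Ψ) :
    (orthoAdjMatrix Ψ * tangentMatrix Ψ) S T = tangentCount Ψ S.rep T.rep := by
  classical
  have hrep := isUnitRep_rep hq hΨ
  rw [← card_tangent hq hΨ (hrep T).self, mul_apply]
  simp only [orthoAdjMatrix_apply hq hΨ, tangentMatrix_apply]
  rw [sum_boole_mul_boole]
  congr 1
  refine Nat.card_congr (Equiv.subtypeEquivRight fun U => ?_)
  rw [hΨ.eq_zero_comm]

theorem formCount_top (hq : Nat.card K = q ^ 2) (hΨ : IsUnitary τ Ψ)
    (hn : Module.finrank K V = k + 3) :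
    (formCount Ψ ⊤ 1 : ℝ) = (q : ℝ) ^ 5 * (q ^ k) ^ 2 + (-1) ^ k * q ^ 2 * q ^ k := by
  classical
  have hq0 : (q : ℝ) ≠ 0 := by have := one_lt_of_card_eq_sq hq; positivity
  have h := formCount_eq hq hΨ (map_one τ) (d := 0) (r := k + 3) (W := ⊤)
    (by rw [radicalOn_top hΨ, finrank_bot]) (by rw [finrank_top, hn, zero_add])
  rw [if_neg one_ne_zero, neg_pow] at h
  apply mul_left_cancel₀ hq0
  rw [h]; ring

theorem formCount_perpTo_one (hq : Nat.card K = q ^ 2) (hΨ : IsUnitary τ Ψ)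
    (hn : Module.finrank K V = k + 3) {t : V} (ht : Ψ t t = 1) :
    (formCount Ψ (perpTo Ψ t) 1 : ℝ) = (q : ℝ) ^ 3 * (q ^ k) ^ 2 - (-1) ^ k * q * q ^ k := by
  classical
  have hq0 : (q : ℝ) ≠ 0 := by have := one_lt_of_card_eq_sq hq; positivity
  have h := formCount_eq hq hΨ (map_one τ) (d := 0) (r := k + 2) (W := perpTo Ψ t)
    (by rw [radicalOn_perpTo hΨ ht, finrank_bot]) (by rw [finrank_perpTo hn ht, zero_add])
  rw [if_neg one_ne_zero, neg_pow] at h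
  apply mul_left_cancel₀ hq0
  rw [h]; ring

theorem formCount_perpTo_zero (hq : Nat.card K = q ^ 2) (hΨ : IsUnitary τ Ψ)
    (hn : Module.finrank K V = k + 3) {t : V} (ht : Ψ t t = 1) :
    (formCount Ψ (perpTo Ψ t) 0 : ℝ) =
      (q : ℝ) ^ 3 * (q ^ k) ^ 2 + (-1) ^ k * q * (q - 1) * q ^ k := by
  classical
  have hq0 : (q : ℝ) ≠ 0 := by have := one_lt_of_card_eq_sq hq; positivity
  have h := formCount_eq hq hΨ (map_zero τ) (d := 0) (r := k + 2) (W := perpTo Ψ t)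
    (by rw [radicalOn_perpTo hΨ ht, finrank_bot]) (by rw [finrank_perpTo hn ht, zero_add])
  rw [if_pos rfl, neg_pow] at h
  apply mul_left_cancel₀ hq0
  rw [h]; ring

section Pair

variable {s t : V}

theorem formCount_perpTo_inf_one_of_ne (hq : Nat.card K = q ^ 2) (hΨ : IsUnitary τ Ψ)
    (hn : Module.finrank K V = k + 3) (hs : Ψ s s = 1) (ht : Ψ t t = 1) (hst : s ≠ Ψ s t • t)
    (h : Ψ s t * τ (Ψ s t) ≠ 1) :
    (formCount Ψ (perpTo Ψ t ⊓ perpTo Ψ s) 1 : ℝ) = q * (q ^ k) ^ 2 + (-1) ^ k * q ^ k := by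
  classical
  have hq0 : (q : ℝ) ≠ 0 := by have := one_lt_of_card_eq_sq hq; positivity
  have h := formCount_eq hq hΨ (map_one τ) (d := 0) (r := k + 1) (W := perpTo Ψ t ⊓ perpTo Ψ s)
    (by rw [radicalOn_perpTo_inf_of_ne hΨ ht hs hst h, finrank_bot])
    (by rw [finrank_perpTo_inf hΨ hn ht hst, zero_add])
  rw [if_neg one_ne_zero, neg_pow] at h
  apply mul_left_cancel₀ hq0
  rw [h]; ring

theorem formCount_perpTo_inf_zero_of_ne (hq : Nat.card K = q ^ 2) (hΨ : IsUnitary τ Ψ)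
    (hn : Module.finrank K V = k + 3) (hs : Ψ s s = 1) (ht : Ψ t t = 1) (hst : s ≠ Ψ s t • t)
    (h : Ψ s t * τ (Ψ s t) ≠ 1) :
    (formCount Ψ (perpTo Ψ t ⊓ perpTo Ψ s) 0 : ℝ) =
      q * (q ^ k) ^ 2 - (-1) ^ k * (q - 1) * q ^ k := by
  classical
  have hq0 : (q : ℝ) ≠ 0 := by have := one_lt_of_card_eq_sq hq; positivity
  have h := formCount_eq hq hΨ (map_zero τ) (d := 0) (r := k + 1) (W := perpTo Ψ t ⊓ perpTo Ψ s)
    (by rw [radicalOn_perpTo_inf_of_ne hΨ ht hs hst h, finrank_bot])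
    (by rw [finrank_perpTo_inf hΨ hn ht hst, zero_add])
  rw [if_pos rfl, neg_pow] at h
  apply mul_left_cancel₀ hq0
  rw [h]; ring

theorem formCount_perpTo_inf_one_of_eq (hq : Nat.card K = q ^ 2) (hΨ : IsUnitary τ Ψ)
    (hn : Module.finrank K V = k + 3) (hs : Ψ s s = 1) (ht : Ψ t t = 1) (hst : s ≠ Ψ s t • t)
    (h : Ψ s t * τ (Ψ s t) = 1) :
    (formCount Ψ (perpTo Ψ t ⊓ perpTo Ψ s) 1 : ℝ) = q * (q ^ k) ^ 2 - (-1) ^ k * q * q ^ k := by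
  classical
  have hq0 : (q : ℝ) ≠ 0 := by have := one_lt_of_card_eq_sq hq; positivity
  have h := formCount_eq hq hΨ (map_one τ) (d := 1) (r := k) (W := perpTo Ψ t ⊓ perpTo Ψ s)
    (finrank_radicalOn_perpTo_inf_of_eq hΨ ht hs hst h)
    (by rw [finrank_perpTo_inf hΨ hn ht hst, add_comm])
  rw [if_neg one_ne_zero, neg_pow] at h
  apply mul_left_cancel₀ hq0
  rw [h]; ring

theorem formCount_perpTo_inf_zero_of_eq (hq : Nat.card K = q ^ 2) (hΨ : IsUnitary τ Ψ)
    (hn : Module.finrank K V = k + 3) (hs : Ψ s s = 1) (ht : Ψ t t = 1) (hst : s ≠ Ψ s t • t)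
    (h : Ψ s t * τ (Ψ s t) = 1) :
    (formCount Ψ (perpTo Ψ t ⊓ perpTo Ψ s) 0 : ℝ) =
      q * (q ^ k) ^ 2 + (-1) ^ k * q * (q - 1) * q ^ k := by
  classical
  have hq0 : (q : ℝ) ≠ 0 := by have := one_lt_of_card_eq_sq hq; positivity
  have h := formCount_eq hq hΨ (map_zero τ) (d := 1) (r := k) (W := perpTo Ψ t ⊓ perpTo Ψ s)
    (finrank_radicalOn_perpTo_inf_of_eq hΨ ht hs hst h)
    (by rw [finrank_perpTo_inf hΨ hn ht hst, add_comm])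
  rw [if_pos rfl, neg_pow] at h
  apply mul_left_cancel₀ hq0
  rw [h]; ring

end Pair

theorem orthoAdjMatrix_sq_diag (hq : Nat.card K = q ^ 2) (hΨ : IsUnitary τ Ψ)
    (hn : Module.finrank K V = k + 3) (S : NondegLine Ψ) :
    (orthoAdjMatrix Ψ * orthoAdjMatrix Ψ) S S =
      ((q : ℝ) ^ 3 * (q ^ k) ^ 2 - (-1) ^ k * q * q ^ k) / (q + 1) := by
  have hrep := isUnitRep_rep hq hΨ
  have h1 : (q : ℝ) + 1 ≠ 0 := by positivity
  rw [eq_div_iff h1, mul_comm, sq_apply hq hΨ, inf_idem,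
    formCount_perpTo_one hq hΨ hn (hrep S).self]

-- The coefficient of J is the value at a pair spanning a nondegenerate plane, that of B the change
-- at a degenerate plane; I corrects the diagonal, where B is also 1.
open Classical in
theorem orthoAdjMatrix_sq (hq : Nat.card K = q ^ 2) (hΨ : IsUnitary τ Ψ)
    (hn : Module.finrank K V = k + 3) :
    orthoAdjMatrix Ψ * orthoAdjMatrix Ψ =
      (((q : ℝ) * (q ^ k) ^ 2 + (-1) ^ k * q ^ k) / (q + 1)) • of (fun _ _ => (1 : ℝ)) +
        ((q : ℝ) * (q - 1) * (q ^ k) ^ 2) • (1 : Matrix (NondegLine Ψ) (NondegLine Ψ) ℝ) +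
        (-(-1) ^ k * (q : ℝ) ^ k) • tangentMatrix Ψ := by
  have hrep := isUnitRep_rep hq hΨ
  have h1 : (q : ℝ) + 1 ≠ 0 := by positivity
  ext S T
  simp only [Matrix.add_apply, Matrix.smul_apply, of_apply, one_apply, smul_eq_mul, mul_one]
  by_cases hST : S = T
  · subst hST
    rw [tangentMatrix_apply, orthoAdjMatrix_sq_diag hq hΨ hn, (hrep S).self, map_one,
      mul_one, if_pos rfl, if_pos rfl]
    field_simp
    ring
  · have hst : S.rep ≠ Ψ S.rep T.rep • T.rep := fun h =>
      hST ((hrep S).eq_of_smul (hrep T) h)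
    rw [if_neg hST]
    apply mul_left_cancel₀ h1
    rw [sq_apply hq hΨ, tangentMatrix_apply]
    split_ifs with h
    · rw [formCount_perpTo_inf_one_of_eq hq hΨ hn (hrep S).self (hrep T).self hst h]
      field_simp
      ring
    · rw [formCount_perpTo_inf_one_of_ne hq hΨ hn (hrep S).self (hrep T).self hst h]
      field_simp
      ring

-- Four cases fix the coefficients: coinciding, orthogonal, degenerate plane, and the rest. The rest
-- give the coefficient of J.
open Classical in
theorem orthoAdjMatrix_mul_tangentMatrix (hq : Nat.card K = q ^ 2) (hΨ : IsUnitary τ Ψ)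
    (hn : Module.finrank K V = k + 3) :
    orthoAdjMatrix Ψ * tangentMatrix Ψ =
      ((q : ℝ) * (q ^ k) ^ 2 + (-1) ^ k * q ^ k) • of (fun _ _ => (1 : ℝ)) +
        (-((q : ℝ) * (q ^ k) ^ 2)) • (1 : Matrix (NondegLine Ψ) (NondegLine Ψ) ℝ) +
        (-(-1) ^ k * (q : ℝ) ^ k) • tangentMatrix Ψ +
        (-(-1) ^ k * (q : ℝ) * (q : ℝ) ^ k) • orthoAdjMatrix Ψ := by
  have hrep := isUnitRep_rep hq hΨ
  have hq1 : (1 : ℝ) < q := by exact_mod_cast one_lt_of_card_eq_sq hq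
  have h1 : (q : ℝ) ^ 2 - 1 ≠ 0 := by nlinarith
  ext S T
  simp only [Matrix.add_apply, Matrix.smul_apply, of_apply, one_apply, smul_eq_mul, mul_one]
  rw [mul_tangentMatrix_apply hq hΨ, tangentMatrix_apply, orthoAdjMatrix_apply hq hΨ]
  by_cases hST : S = T
  · subst hST
    rw [tangentCount_self (hrep S).self, (hrep S).self, map_one, mul_one, if_pos rfl, if_pos rfl,
      if_neg one_ne_zero]
    push_cast
    ring
  have hst : S.rep ≠ Ψ S.rep T.rep • T.rep := fun h => hST ((hrep S).eq_of_smul (hrep T) h)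
  rw [if_neg hST]
  by_cases hort : Ψ S.rep T.rep = 0
  · have hne : Ψ S.rep T.rep * τ (Ψ S.rep T.rep) ≠ 1 := by rw [hort]; simp
    rw [tangentCount_of_orthogonal (hΨ.eq_zero_comm.1 hort), if_neg hne, if_pos hort,
      formCount_perpTo_inf_zero_of_ne hq hΨ hn (hrep S).self (hrep T).self hst hne]
    ring
  · rw [if_neg hort]
    apply mul_left_cancel₀ h1
    rw [tangentCount_of_not_orthogonal hq (mt hΨ.eq_zero_comm.1 hort),
      formCount_perpTo_zero hq hΨ hn (hrep T).self]
    split_ifs with h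
    · rw [formCount_perpTo_inf_zero_of_eq hq hΨ hn (hrep S).self (hrep T).self hst h]
      ring
    · rw [formCount_perpTo_inf_zero_of_ne hq hΨ hn (hrep S).self (hrep T).self hst h]
      ring

theorem card_eq (hq : Nat.card K = q ^ 2) (hΨ : IsUnitary τ Ψ)
    (hn : Module.finrank K V = k + 3) :
    (Fintype.card (NondegLine Ψ) : ℝ) =
      ((q : ℝ) ^ 5 * (q ^ k) ^ 2 + (-1) ^ k * q ^ 2 * q ^ k) / (q + 1) := by
  have h1 : (q : ℝ) + 1 ≠ 0 := by positivity
  have h := card_le hq hΨ ⊤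
  rw [Nat.card_congr (Equiv.subtypeUnivEquiv fun S => le_top), Nat.card_eq_fintype_card] at h
  rw [eq_div_iff h1, ← formCount_top hq hΨ hn, ← h]
  push_cast; ring

theorem ncard_neighborSet (hq : Nat.card K = q ^ 2) (hΨ : IsUnitary τ Ψ)
    (hn : Module.finrank K V = k + 3) (S : NondegLine Ψ) :
    (((orthoGraph Ψ).neighborSet S).ncard : ℝ) =
      ((q : ℝ) ^ 3 * (q ^ k) ^ 2 - (-1) ^ k * q * q ^ k) / (q + 1) := by
  have hrep := isUnitRep_rep hq hΨ
  have h1 : (q : ℝ) + 1 ≠ 0 := by positivity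
  rw [eq_div_iff h1, ← formCount_perpTo_one hq hΨ hn (hrep S).self, ← card_le hq hΨ,
    ← Nat.card_coe_set_eq, mul_comm]
  push_cast
  congr 2
  refine Nat.card_congr (Equiv.subtypeEquivRight fun U => ?_)
  rw [(hrep U).le_iff, mem_perpTo, SimpleGraph.mem_neighborSet, (hrep S).adj_iff hΨ (hrep U),
    hΨ.eq_zero_comm]

theorem orthoAdjMatrix_mulVec_one (hq : Nat.card K = q ^ 2) (hΨ : IsUnitary τ Ψ)
    (hn : Module.finrank K V = k + 3) :
    orthoAdjMatrix Ψ *ᵥ (fun _ => 1) =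
      fun _ => ((q : ℝ) ^ 3 * (q ^ k) ^ 2 - (-1) ^ k * q * q ^ k) / (q + 1) := by
  classical
  ext S
  rw [← ncard_neighborSet hq hΨ hn S, Set.ncard_eq_toFinset_card']
  simp only [mulVec, dotProduct, mul_one, orthoAdjMatrix, SimpleGraph.adjMatrix_apply,
    Finset.sum_boole]
  congr 2
  ext T
  simp

-- Multiply the formula for A² by A and substitute that for AB. In A³ + εQ A² the terms in B cancel,
-- which is how the root -εQ arises.
open Classical in
theorem isThreeRegular_orthoAdjMatrix (hq : Nat.card K = q ^ 2) (hΨ : IsUnitary τ Ψ)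
    (hn : Module.finrank K V = k + 3) :
    ∃ κ, IsThreeRegular (orthoAdjMatrix Ψ)
      (((q : ℝ) ^ 3 * (q ^ k) ^ 2 - (-1) ^ k * q * q ^ k) / (q + 1))
      (q * q ^ k) (-(-1) ^ k * q ^ k) (-(q * q ^ k)) κ := by
  have hsymm : (orthoAdjMatrix Ψ)ᵀ = orthoAdjMatrix Ψ := SimpleGraph.transpose_adjMatrix _
  have hrow := orthoAdjMatrix_mulVec_one hq hΨ hn
  set d : ℝ := ((q : ℝ) ^ 3 * (q ^ k) ^ 2 - (-1) ^ k * q * q ^ k) / (q + 1)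
  have hJ : orthoAdjMatrix Ψ * of (fun _ _ => (1 : ℝ)) = d • of (fun _ _ => (1 : ℝ)) := by
    ext i j
    simpa [mul_apply, mulVec, dotProduct] using congrFun hrow i
  have he : ((-1 : ℝ) ^ k) ^ 2 = 1 := by rw [← pow_mul, mul_comm, pow_mul]; simp
  have h2 := orthoAdjMatrix_sq hq hΨ hn
  have h3 := orthoAdjMatrix_mul_tangentMatrix hq hΨ hn
  -- This κ is the coefficient of J in A³ + εQ A², computed using A J = d J.
  refine ⟨((q : ℝ) * (q ^ k) ^ 2 + (-1) ^ k * q ^ k) / (q + 1) * (d + (-1) ^ k * q ^ k) -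
    (-1) ^ k * q ^ k * ((q : ℝ) * (q ^ k) ^ 2 + (-1) ^ k * q ^ k), hsymm, ?_, hrow, ?_, ?_⟩
  · exact SimpleGraph.trace_adjMatrix _ _
  · simp [Matrix.trace, orthoAdjMatrix_sq_diag hq hΨ hn, d]
  · have hlhs : (orthoAdjMatrix Ψ - ((q : ℝ) * q ^ k) • 1) *
        ((orthoAdjMatrix Ψ - (-(-1) ^ k * (q : ℝ) ^ k) • 1) *
          (orthoAdjMatrix Ψ - (-((q : ℝ) * q ^ k)) • 1)) =
        orthoAdjMatrix Ψ * (orthoAdjMatrix Ψ * orthoAdjMatrix Ψ) -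
          (-(-1) ^ k * (q : ℝ) ^ k) • (orthoAdjMatrix Ψ * orthoAdjMatrix Ψ) -
          ((q : ℝ) * q ^ k) ^ 2 • orthoAdjMatrix Ψ +
          ((-(-1) ^ k * (q : ℝ) ^ k) * ((q : ℝ) * q ^ k) ^ 2) • 1 := by
      simp only [mul_sub, sub_mul, mul_smul_comm, smul_mul_assoc, mul_one, one_mul, smul_sub,
        smul_smul, mul_assoc]
      module
    rw [hlhs, h2, mul_add, mul_add, mul_smul_comm, mul_smul_comm, mul_smul_comm, hJ, h3, mul_one]
    match_scalars
    · ring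
    -- The coefficient of A is qQ²(ε² - 1).
    · linear_combination (q * ((q : ℝ) ^ k) ^ 2) * he
    · ring
    · ring

end NondegLine

/-! ### Closed forms of the parameters in terms of k = n - 3. -/

section Parameters

variable {q : ℕ} (k : ℕ)

theorem dNum_add_two : dNum q ((k + 2 : ℕ) : ℤ) =
    (q : ℝ) ^ k * (q * q ^ k + (-1) ^ k) / (q + 1) := by
  rw [dNum, show ((k + 2 : ℕ) : ℤ) - 2 = (k : ℕ) by push_cast; ring,
    show ((k + 2 : ℕ) : ℤ) - 1 = (k + 1 : ℕ) by push_cast; ring]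
  simp only [zpow_natCast]
  ring

theorem alphaTwo_add_three (hq : 1 < q) : alphaTwo q ((k + 3 : ℕ) : ℤ) =
    ((q : ℝ) ^ 2 * q ^ k - (-1) ^ k) * (q ^ 3 * q ^ k + (-1) ^ k) * (q ^ 2 - q - 1 + (-1) ^ k) /
      (2 * (q + 1) ^ 2 * (q - 1)) := by
  have h0 : (q : ℝ) ≠ 0 := by positivity
  have h1 : (q : ℝ) - 1 ≠ 0 := by
    have : (1 : ℝ) < q := by exact_mod_cast hq
    linarith
  rw [alphaTwo, show ((k + 3 : ℕ) : ℤ) + 1 = ((k + 2) + 2 : ℕ) by push_cast; ring,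
    show ((k + 3 : ℕ) : ℤ) = ((k + 1) + 2 : ℕ) by push_cast; ring, dNum_add_two,
    dNum_add_two,
    show 2 * ((k + 1 + 2 : ℕ) : ℤ) - 3 = (2 * k + 3 : ℕ) by push_cast; ring]
  simp only [zpow_natCast, pow_add, pow_mul']
  field_simp
  ring

theorem alphaFour_add_three (hq : 1 < q) : alphaFour q ((k + 3 : ℕ) : ℤ) =
    ((q : ℝ) ^ 2 * q ^ k - (-1) ^ k) * (q ^ 3 * q ^ k + (-1) ^ k) * (q ^ 2 - q - 1 - (-1) ^ k) /
      (2 * (q + 1) ^ 2 * (q - 1)) := by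
  have h0 : (q : ℝ) ≠ 0 := by positivity
  have h1 : (q : ℝ) - 1 ≠ 0 := by
    have : (1 : ℝ) < q := by exact_mod_cast hq
    linarith
  rw [alphaFour, show ((k + 3 : ℕ) : ℤ) + 1 = ((k + 2) + 2 : ℕ) by push_cast; ring,
    show ((k + 3 : ℕ) : ℤ) = ((k + 1) + 2 : ℕ) by push_cast; ring, dNum_add_two,
    dNum_add_two,
    show 2 * ((k + 1 + 2 : ℕ) : ℤ) - 3 = (2 * k + 3 : ℕ) by push_cast; ring]
  simp only [zpow_natCast, pow_add, pow_mul']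
  field_simp
  ring

theorem alphaThree_add_three (hq : 1 < q) : alphaThree q ((k + 3 : ℕ) : ℤ) =
    (q : ℝ) ^ 3 * (q ^ 2 * q ^ k - (-1) ^ k) * (q * q ^ k + (-1) ^ k) /
      ((q + 1) ^ 2 * (q - 1)) := by
  have h0 : (q : ℝ) ≠ 0 := by positivity
  have h1 : (q : ℝ) - 1 ≠ 0 := by
    have : (1 : ℝ) < q := by exact_mod_cast hq
    linarith
  -- The exponent is 2k - 2, negative for k = 0, so it is handled as an integer power.
  have h2 : (q : ℝ) ^ (2 * ((k + 3 : ℕ) : ℤ) - 8) = (q ^ k) ^ 2 / q ^ 2 := by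
    rw [show 2 * ((k + 3 : ℕ) : ℤ) - 8 = (2 * k : ℕ) - (2 : ℕ) by push_cast; ring,
      zpow_sub₀ h0, zpow_natCast, zpow_natCast, pow_mul']
  rw [alphaThree, h2, show ((k + 3 : ℕ) : ℤ) - 1 = (k + 2 : ℕ) by push_cast; ring,
    show ((k + 3 : ℕ) : ℤ) = ((k + 1) + 2 : ℕ) by push_cast; ring, dNum_add_two,
    dNum_add_two]
  simp only [pow_add]
  field_simp
  ring

theorem dNum_add_three : dNum q ((k + 3 : ℕ) : ℤ) =
    ((q : ℝ) ^ 3 * (q ^ k) ^ 2 - (-1) ^ k * q * q ^ k) / (q + 1) := by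
  rw [show ((k + 3 : ℕ) : ℤ) = ((k + 1) + 2 : ℕ) by push_cast; ring, dNum_add_two]
  ring

end Parameters

/-! ### Separation of the eigenvalues and their multiplicities. -/

namespace NondegLine

open Matrix

variable {K V : Type*} [Field K] [Finite K] [AddCommGroup V] [Module K V]
  [FiniteDimensional K V] {τ : K ≃+* K}
  {Ψ : V →ₗ[K] V →ₛₗ[(τ : K →+* K)] K} {q k : ℕ}

theorem nonempty (hq : Nat.card K = q ^ 2) (hΨ : IsUnitary τ Ψ)
    (hn : Module.finrank K V = k + 3) : Nonempty (NondegLine Ψ) := by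
  have h := card_eq hq hΨ hn
  have hq1 : (1 : ℝ) < q := by exact_mod_cast one_lt_of_card_eq_sq hq
  have hQ : (1 : ℝ) ≤ q ^ k := one_le_pow₀ hq1.le
  have hpos : 0 < ((q : ℝ) ^ 5 * (q ^ k) ^ 2 + (-1) ^ k * q ^ 2 * q ^ k) / (q + 1) := by
    apply div_pos _ (by linarith)
    have h3 : (1 : ℝ) < q ^ 3 * q ^ k :=
      one_lt_mul_of_lt_of_le (one_lt_pow₀ hq1 (by norm_num)) hQ
    have h4 : (0 : ℝ) < q ^ 2 * q ^ k := by positivity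
    rcases neg_one_pow_eq_or ℝ k with he | he <;> rw [he] <;> nlinarith
  rw [← h] at hpos
  exact Fintype.card_pos_iff.1 (by exact_mod_cast hpos)

section Degree

variable {x y e : ℝ}

theorem degree_pos (hx : 2 ≤ x) (hy : 1 ≤ y) (he : e = 1 ∨ e = -1) :
    0 < (x ^ 3 * y ^ 2 - e * x * y) / (x + 1) := by
  apply div_pos _ (by linarith)
  have h1 : 0 < x * y := by positivity
  have h2 : 1 < x ^ 2 * y := by nlinarith
  rcases he with rfl | rfl <;> nlinarith

theorem degree_ne_mid (hx : 2 ≤ x) (hy : 1 ≤ y) (he : e = 1 ∨ e = -1) :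
    (x ^ 3 * y ^ 2 - e * x * y) / (x + 1) ≠ -e * y := by
  have h0 := degree_pos hx hy he
  rcases he with rfl | rfl
  · linarith
  · intro h
    rw [div_eq_iff (by linarith)] at h
    have h1 : y * (x ^ 3 * y - 1) = 0 := by linear_combination h
    rcases mul_eq_zero.1 h1 with h2 | h2
    · linarith
    · have h3 : 1 < x ^ 3 := one_lt_pow₀ (by linarith) (by norm_num)
      nlinarith

/-- Cancelling xy leaves x²y = x + 1 + e ≤ x + 2; with y ≥ 1 and x ≥ 2 this forces x = 2, then y =
1. -/
theorem degree_eq_top (hx : 2 ≤ x) (hy : 1 ≤ y) (he : e = 1 ∨ e = -1)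
    (h : (x ^ 3 * y ^ 2 - e * x * y) / (x + 1) = x * y) : x = 2 ∧ y = 1 := by
  rw [div_eq_iff (by linarith)] at h
  have h0 : x * y ≠ 0 := by positivity
  have h1 : x ^ 2 * y - e = x + 1 := by
    apply mul_left_cancel₀ h0
    linear_combination h
  have h2 : e ≤ 1 := by rcases he with rfl | rfl <;> norm_num
  have h3 : x ^ 2 ≤ x ^ 2 * y := le_mul_of_one_le_right (sq_nonneg x) hy
  have hx2 : x = 2 := by nlinarith
  subst hx2
  exact ⟨rfl, by linarith⟩

end Degree

theorem two_le_and_one_le (hq : Nat.card K = q ^ 2) (k : ℕ) :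
    (2 : ℝ) ≤ q ∧ (1 : ℝ) ≤ q ^ k := by
  have h : (2 : ℝ) ≤ q := by exact_mod_cast one_lt_of_card_eq_sq hq
  exact ⟨h, one_le_pow₀ (by linarith)⟩

theorem ne_of_two_le {x y e : ℝ} (hx : 2 ≤ x) (hy : 1 ≤ y) (he : e = 1 ∨ e = -1) :
    x * y ≠ -e * y ∧ x * y ≠ -(x * y) ∧ -e * y ≠ -(x * y) := by
  have h1 : y < x * y := by nlinarith
  refine ⟨?_, by linarith, ?_⟩ <;> rcases he with rfl | rfl <;> linarith

theorem degree_ne_top (hq : Nat.card K = q ^ 2) (hne : q = 2 → k ≠ 0) :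
    ((q : ℝ) ^ 3 * (q ^ k) ^ 2 - (-1) ^ k * q * q ^ k) / (q + 1) ≠ q * q ^ k := by
  obtain ⟨hx, hy⟩ := two_le_and_one_le hq k
  intro hd
  obtain ⟨h4, h5⟩ := degree_eq_top hx hy (neg_one_pow_eq_or ℝ k) hd
  have h6 : q = 2 := by exact_mod_cast h4
  refine hne h6 ?_
  by_contra hk
  rw [h4] at h5
  exact (one_lt_pow₀ (by norm_num : (1 : ℝ) < 2) hk).ne' h5

theorem hasMultiplicity_three (hq : Nat.card K = q ^ 2) (hΨ : IsUnitary τ Ψ)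
    (hn : Module.finrank K V = k + 3) :
    HasMultiplicity (orthoAdjMatrix Ψ) (-(-1) ^ k * q ^ k) (alphaThree q ((k + 3 : ℕ) : ℤ)) := by
  classical
  obtain ⟨hx, hy⟩ := two_le_and_one_le hq k
  have he := neg_one_pow_eq_or ℝ k
  obtain ⟨κ, h⟩ := isThreeRegular_orthoAdjMatrix hq hΨ hn
  have := nonempty hq hΨ hn
  obtain ⟨h1, h2, h3⟩ := ne_of_two_le hx hy he
  apply hasMultiplicity_of_finrank h.symm
  rw [h.rotate.finrank_eigenspace_of_ne h3 h1.symm (degree_ne_mid hx hy he), card_eq hq hΨ hn,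
    alphaThree_add_three _ (one_lt_of_card_eq_sq hq)]
  generalize (q : ℝ) ^ k = y at *
  generalize (-1 : ℝ) ^ k = e at *
  generalize (q : ℝ) = x at *
  have h4 : (-e * y - -(x * y)) * (-e * y - x * y) ≠ 0 :=
    mul_ne_zero (sub_ne_zero.2 h3) (sub_ne_zero.2 h1.symm)
  have h5 : x - 1 ≠ 0 := by linarith
  have h6 : x + 1 ≠ 0 := by linarith
  have h7 : y ≠ 0 := by linarith
  rw [div_eq_div_iff h4 (mul_ne_zero (pow_ne_zero 2 h6) h5)]
  -- Substituting ε = ±1 supplies ε² = 1, leaving an identity in x = q and y = Q alone.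
  rcases he with rfl | rfl <;> field_simp <;> ring

theorem hasMultiplicity_two (hq : Nat.card K = q ^ 2) (hΨ : IsUnitary τ Ψ)
    (hn : Module.finrank K V = k + 3) (hne : q = 2 → k ≠ 0) :
    HasMultiplicity (orthoAdjMatrix Ψ) (q * q ^ k) (alphaTwo q ((k + 3 : ℕ) : ℤ)) := by
  classical
  obtain ⟨hx, hy⟩ := two_le_and_one_le hq k
  have he := neg_one_pow_eq_or ℝ k
  obtain ⟨κ, h⟩ := isThreeRegular_orthoAdjMatrix hq hΨ hn
  have := nonempty hq hΨ hn
  obtain ⟨h1, h2, h3⟩ := ne_of_two_le hx hy he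
  have hd := degree_ne_top hq hne
  apply hasMultiplicity_of_finrank h.symm
  rw [h.finrank_eigenspace_of_ne h1 h2 hd, card_eq hq hΨ hn,
    alphaTwo_add_three _ (one_lt_of_card_eq_sq hq)]
  generalize (q : ℝ) ^ k = y at *
  generalize (-1 : ℝ) ^ k = e at *
  generalize (q : ℝ) = x at *
  have h4 : (x * y - -e * y) * (x * y - -(x * y)) ≠ 0 :=
    mul_ne_zero (sub_ne_zero.2 h1) (sub_ne_zero.2 h2)
  have h5 : x - 1 ≠ 0 := by linarith
  have h6 : x + 1 ≠ 0 := by linarith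
  rw [div_eq_div_iff h4 (mul_ne_zero (mul_ne_zero two_ne_zero (pow_ne_zero 2 h6)) h5)]
  rcases he with rfl | rfl <;> field_simp <;> ring

theorem hasMultiplicity_four (hq : Nat.card K = q ^ 2) (hΨ : IsUnitary τ Ψ)
    (hn : Module.finrank K V = k + 3) :
    HasMultiplicity (orthoAdjMatrix Ψ) (-(q * q ^ k)) (alphaFour q ((k + 3 : ℕ) : ℤ)) := by
  classical
  obtain ⟨hx, hy⟩ := two_le_and_one_le hq k
  have he := neg_one_pow_eq_or ℝ k
  obtain ⟨κ, h⟩ := isThreeRegular_orthoAdjMatrix hq hΨ hn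
  have := nonempty hq hΨ hn
  obtain ⟨h1, h2, h3⟩ := ne_of_two_le hx hy he
  have hd := degree_pos hx hy he
  have hxy : (0 : ℝ) < q * q ^ k := by positivity
  apply hasMultiplicity_of_finrank h.symm
  rw [h.rotate.rotate.finrank_eigenspace_of_ne h2.symm h3.symm (by linarith), card_eq hq hΨ hn,
    alphaFour_add_three _ (one_lt_of_card_eq_sq hq)]
  generalize (q : ℝ) ^ k = y at *
  generalize (-1 : ℝ) ^ k = e at *
  generalize (q : ℝ) = x at *
  have h4 : (-(x * y) - x * y) * (-(x * y) - -e * y) ≠ 0 :=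
    mul_ne_zero (sub_ne_zero.2 h2.symm) (sub_ne_zero.2 h3.symm)
  have h5 : x - 1 ≠ 0 := by linarith
  have h6 : x + 1 ≠ 0 := by linarith
  rw [div_eq_div_iff h4 (mul_ne_zero (mul_ne_zero two_ne_zero (pow_ne_zero 2 h6)) h5)]
  rcases he with rfl | rfl <;> field_simp <;> ring

theorem hasMultiplicity_one (hq : Nat.card K = q ^ 2) (hΨ : IsUnitary τ Ψ)
    (hn : Module.finrank K V = k + 3) (hne : q = 2 → k ≠ 0) :
    HasMultiplicity (orthoAdjMatrix Ψ) (dNum q ((k + 3 : ℕ) : ℤ)) 1 := by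
  classical
  obtain ⟨hx, hy⟩ := two_le_and_one_le hq k
  have he := neg_one_pow_eq_or ℝ k
  obtain ⟨κ, h⟩ := isThreeRegular_orthoAdjMatrix hq hΨ hn
  have := nonempty hq hΨ hn
  have hd := degree_pos hx hy he
  have hxy : (0 : ℝ) < q * q ^ k := by positivity
  apply hasMultiplicity_of_finrank h.symm
  rw [dNum_add_three]
  refine h.finrank_eigenspace_rowSum (fun hd => ?_) (degree_ne_mid hx hy he) (by linarith)
  exact degree_ne_top hq hne hd

theorem hasMultiplicity_one_of_eq (hq : Nat.card K = 2 ^ 2) (hΨ : IsUnitary τ Ψ)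
    (hn : Module.finrank K V = 3) :
    HasMultiplicity (orthoAdjMatrix Ψ) 2 4 := by
  classical
  obtain ⟨κ, h⟩ := isThreeRegular_orthoAdjMatrix (k := 0) hq hΨ hn
  have := nonempty (k := 0) hq hΨ hn
  have hN := card_eq (k := 0) hq hΨ hn
  apply hasMultiplicity_of_finrank h.symm
  -- Here N = 12, d = 2 and the roots are 2, -1, -2, so the multiplicity is 12 · (2 + 2) / (3 · 4).
  norm_num at h hN
  rw [h.finrank_eigenspace_of_eq (by norm_num) (by norm_num), hN]
  norm_num

end NondegLine

theorem corollary4p1 {K V : Type*} [Field K] [Finite K] [AddCommGroup V] [Module K V]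
    [FiniteDimensional K V] (q n : ℕ) (hq : Nat.card K = q ^ 2)
    (hn : Module.finrank K V = n) (hn3 : 3 ≤ n)
    (τ : K ≃+* K) (Ψ : V →ₗ[K] V →ₛₗ[(τ : K →+* K)] K) (hΨ : IsUnitary τ Ψ) :
    (∀ S : NondegLine Ψ, (((orthoGraph Ψ).neighborSet S).ncard : ℝ) = dNum q n) ∧
    (∀ μ : ℝ, Module.End.HasEigenvalue (orthoAdjMatrix Ψ).mulVecLin μ →
      μ = dNum q n ∨ μ = (q : ℝ) ^ (n - 2) ∨ μ = (-1) ^ n * (q : ℝ) ^ (n - 3) ∨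
        μ = -(q : ℝ) ^ (n - 2)) ∧
    (q ≠ 2 →
      HasMultiplicity (orthoAdjMatrix Ψ) (dNum q n) 1 ∧
      HasMultiplicity (orthoAdjMatrix Ψ) ((q : ℝ) ^ (n - 2)) (alphaTwo q n) ∧
      HasMultiplicity (orthoAdjMatrix Ψ) ((-1) ^ n * (q : ℝ) ^ (n - 3)) (alphaThree q n) ∧
      HasMultiplicity (orthoAdjMatrix Ψ) (-(q : ℝ) ^ (n - 2)) (alphaFour q n)) ∧
    (q = 2 → Even n →
      HasMultiplicity (orthoAdjMatrix Ψ) (dNum q n) 1 ∧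
      HasMultiplicity (orthoAdjMatrix Ψ) ((q : ℝ) ^ (n - 2)) 0 ∧
      HasMultiplicity (orthoAdjMatrix Ψ) ((-1) ^ n * (q : ℝ) ^ (n - 3)) (alphaThree q n) ∧
      HasMultiplicity (orthoAdjMatrix Ψ) (-(q : ℝ) ^ (n - 2)) (alphaTwo q n + alphaFour q n)) ∧
    (q = 2 → Odd n → 3 < n →
      HasMultiplicity (orthoAdjMatrix Ψ) (dNum q n) 1 ∧
      HasMultiplicity (orthoAdjMatrix Ψ) ((q : ℝ) ^ (n - 2)) (alphaTwo q n + alphaFour q n) ∧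
      HasMultiplicity (orthoAdjMatrix Ψ) ((-1) ^ n * (q : ℝ) ^ (n - 3)) (alphaThree q n) ∧
      HasMultiplicity (orthoAdjMatrix Ψ) (-(q : ℝ) ^ (n - 2)) 0) ∧
    (q = 2 → n = 3 →
      dNum q n = (q : ℝ) ^ (n - 2) ∧
      1 + alphaTwo q n + alphaFour q n = 4 ∧ alphaThree q n = 8 ∧
      HasMultiplicity (orthoAdjMatrix Ψ) (dNum q n) 4 ∧
      HasMultiplicity (orthoAdjMatrix Ψ) ((-1) ^ n * (q : ℝ) ^ (n - 3)) 8 ∧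
      HasMultiplicity (orthoAdjMatrix Ψ) (-(q : ℝ) ^ (n - 2)) 0) := by
  classical
  obtain ⟨k, rfl⟩ := Nat.exists_eq_add_of_le' hn3
  have hq1 := one_lt_of_card_eq_sq hq
  have e2 : (q : ℝ) ^ (k + 3 - 2) = q * q ^ k := by
    rw [show k + 3 - 2 = k + 1 by omega, pow_succ']
  have e3 : (-1 : ℝ) ^ (k + 3) * (q : ℝ) ^ (k + 3 - 3) = -(-1) ^ k * q ^ k := by
    rw [show k + 3 - 3 = k by omega]; ring
  have ha := alphaTwo_add_three (q := q) k hq1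
  have hb := alphaFour_add_three (q := q) k hq1
  have H1 := NondegLine.hasMultiplicity_one hq hΨ hn
  have H2 := NondegLine.hasMultiplicity_two hq hΨ hn
  have H3 := NondegLine.hasMultiplicity_three hq hΨ hn
  have H4 := NondegLine.hasMultiplicity_four hq hΨ hn
  rw [e2, e3]
  refine ⟨fun S => ?_, fun μ hμ => ?_, fun h => ?_, fun h hpar => ?_, fun h hpar h3 => ?_,
    fun h h3 => ?_⟩
  · rw [NondegLine.ncard_neighborSet hq hΨ hn, dNum_add_three]
  · obtain ⟨κ, h⟩ := NondegLine.isThreeRegular_orthoAdjMatrix hq hΨ hn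
    rw [dNum_add_three]
    exact h.eigenvalue hμ
  · exact ⟨H1 (absurd · h), H2 (absurd · h), H3, H4⟩
  · have hk : Odd k := by
      rw [Nat.even_add'] at hpar
      exact hpar.2 (by decide)
    have hk0 : q = 2 → k ≠ 0 := fun _ => hk.pos.ne'
    -- For even n, ε = -1 and the factor q² - q - 1 + ε vanishes at q = 2.
    have ha0 : alphaTwo q ((k + 3 : ℕ) : ℤ) = 0 := by
      rw [ha, hk.neg_one_pow, h]; norm_num
    have H2' := H2 hk0
    rw [ha0] at H2' ⊢
    rw [zero_add]
    exact ⟨H1 hk0, H2', H3, H4⟩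
  · have hk : Even k := by
      rw [Nat.odd_add'] at hpar
      exact hpar.1 (by decide)
    have hk0 : q = 2 → k ≠ 0 := fun _ => by omega
    -- For odd n, ε = 1 and the factor q² - q - 1 - ε vanishes at q = 2.
    have hb0 : alphaFour q ((k + 3 : ℕ) : ℤ) = 0 := by
      rw [hb, hk.neg_one_pow, h]; norm_num
    rw [hb0] at H4 ⊢
    rw [add_zero]
    exact ⟨H1 hk0, H2 hk0, H3, H4⟩
  · obtain rfl : k = 0 := by omega
    subst h
    have hc := alphaThree_add_three (q := 2) 0 hq1
    have hd := dNum_add_three (q := 2) 0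
    rw [ha, hb, hc, hd]
    rw [hc] at H3
    rw [hb] at H4
    have H0 := NondegLine.hasMultiplicity_one_of_eq hq hΨ hn
    clear H1 H2 ha hb hc hd e2 e3
    norm_num at H0 H3 H4 ⊢
    exact ⟨H0, H3, H4⟩
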